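/- Graphs are finite, simple and undirected, $\log=\log_2$, $\ln=\log_e$, and $\lVert G\rVert=|V(G)|+|E(G)|$. For graphs $G,H$ with $|V(H)|\le|V(G)|$ let $\mathcal G(G,H)$ be the distribution of the random graph $\hat G$ obtained by sampling a uniformly random injective map $\phi:V(H)\to V(G)$ and setting $V(\hat G)=V(G)$, $E(\hat G)=E(G)\cup\{\{\phi(u),\phi(u')\}:\{u,u'\}\in E(H)\}$. The computational model is the unit-cost RAM with words of $O(\log\lVert \hat G\rVert)$ bits; input graphs have vertex set $\{0,\dots,n-1\}$, $n\ge 1$, and are given by sorted adjacency lists. **Theorem.** There exists a deterministic algorithm $\mathcal A$ with the following guarantees. Fix any real $a\ge 1$ and any $c=c(n)\in(0,1]$ with $c(n)\in\omega\left(\frac1{\log n}\right)$, and define $$K(n,c,p)=\frac n5\left(\frac c3\right)^{2+\frac2c\log\frac2p}.$$ Then for every $n$ large enough (depending only on $a$ and the function $c$) and every $n$-vertex graph $G$ the following holds. Let $\Delta$ be the maximum degree of $G$ and $p=1-\frac{\Delta}{n}$. If $K(n,c,p)\ge 1+2a\ln n$, then, with probability at least $1-n^{-a}$ over $\hat G\sim\mathcal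 G(G,K_{cn})$, the algorithm $\mathcal A$ on input $\hat G$ returns a clique of $\hat G$ of size at least $K(n,c,p)$. Here $K_{cn}$ is the complete graph on $cn$ vertices; if $cn$ is not an integer, the claim holds both with $\lfloor cn\rfloor$ and with $\lceil cn\rceil$ vertices. Moreover, $\mathcal A$ runs in time $\tilde O(\lVert\hat G\rVert)$ on every input graph $\hat G$: there are constants $C,d$ such that it always halts within $C\,\lVert\hat G\rVert\,(1+\lfloor\log\lVert\hat G\rVert\rfloor)^d$ steps. -/

import Mathlib

open Filter Asymptotics

/-! ### The random access machine -/

namespace RAM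

/-- Instructions of the unit-cost random access machine. `i`, `j`, `k` are register numbers,
`R i` is the content of register `i`, `M x` the content of the memory cell with address `x`,
and `l` is the position of an instruction in the program. -/
inductive Instr where
  /-- `R i := m` -/
  | const (i m : ℕ)
  /-- `R i := R j` -/
  | copy (i j : ℕ)
  /-- `R i := R j + R k` -/
  | add (i j k : ℕ)
  /-- `R i := max (R j - R k) 0` -/
  | sub (i j k : ℕ)
  /-- `R i := R j * R k` -/
  | mul (i j k : ℕ)
  /-- `R i := ⌊R j / R k⌋` (and `0` when `R k = 0`) -/
  | div (i j k : ℕ)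
  /-- `R i := M (R j)` -/
  | load (i j : ℕ)
  /-- `M (R i) := R j` -/
  | store (i j : ℕ)
  /-- go to instruction `l` -/
  | jump (l : ℕ)
  /-- if `R i < R j` then go to instruction `l` -/
  | jumpLt (i j l : ℕ)
  /-- if `R i = R j` then go to instruction `l` -/
  | jumpEq (i j l : ℕ)

/-- A program is a finite list of instructions, numbered from `0`. -/
abbrev Program := List Instr

/-- A configuration: program counter, registers, memory. -/
@[ext] structure Config where
  pc : ℕ
  reg : ℕ → ℕ
  mem : ℕ → ℕ

/-- Write `x` into register `i` and go to the next instruction. -/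
def Config.setReg (σ : Config) (i x : ℕ) : Config :=
  { σ with pc := σ.pc + 1, reg := Function.update σ.reg i x }

/-- The effect of one instruction. -/
def Instr.exec : Instr → Config → Config
  | const i m, σ => σ.setReg i m
  | copy i j, σ => σ.setReg i (σ.reg j)
  | add i j k, σ => σ.setReg i (σ.reg j + σ.reg k)
  | sub i j k, σ => σ.setReg i (σ.reg j - σ.reg k)
  | mul i j k, σ => σ.setReg i (σ.reg j * σ.reg k)
  | div i j k, σ => σ.setReg i (σ.reg j / σ.reg k)
  | load i j, σ => σ.setReg i (σ.mem (σ.reg j))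
  | store i j, σ =>
      { σ with pc := σ.pc + 1, mem := Function.update σ.mem (σ.reg i) (σ.reg j) }
  | jump l, σ => { σ with pc := l }
  | jumpLt i j l, σ => { σ with pc := if σ.reg i < σ.reg j then l else σ.pc + 1 }
  | jumpEq i j l, σ => { σ with pc := if σ.reg i = σ.reg j then l else σ.pc + 1 }

/-- One step of the machine. It halts when the program counter leaves the program;
a halted configuration does not change any more. -/
def step (P : Program) (σ : Config) : Config :=
  match P[σ.pc]? with
  | none => σ
  | some ins => ins.exec σ

/-- The initial configuration: all registers are `0`, the input occupies the memory cells
`0, 1, 2, …` and the remaining cells are `0`. -/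
def init (input : List ℕ) : Config where
  pc := 0
  reg := fun _ => 0
  mem := fun x => input.getD x 0

/-- The configuration after `t` steps. -/
def run (P : Program) (input : List ℕ) (t : ℕ) : Config :=
  (step P)^[t] (init input)

/-- The machine has halted. -/
def Halted (P : Program) (σ : Config) : Prop := P.length ≤ σ.pc

/-- The output of a halted machine: cell `0` holds its length, the following cells its entries. -/
def output (σ : Config) : List ℕ := (List.range (σ.mem 0)).map fun x => σ.mem (x + 1)

/-- On the given input the program halts and outputs the list `out`. -/
def Outputs (P : Program) (input out : List ℕ) : Prop :=
  ∃ t, Halted P (run P input t) ∧ output (run P input t) = out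

/-- All registers and all memory cells hold numbers below `W`, i.e. words of `log₂ W` bits. -/
def Fits (W : ℕ) (σ : Config) : Prop := (∀ i, σ.reg i < W) ∧ ∀ x, σ.mem x < W

/-- On the given input the program halts after at most `T` steps, and at no time of the
computation does a register or a memory cell hold a number that is not below `W`. -/
def RunsWithin (P : Program) (input : List ℕ) (W T : ℕ) : Prop :=
  ∃ t ≤ T, Halted P (run P input t) ∧ ∀ s ≤ t, Fits W (run P input s)

end RAM

/-! ### Graphs as inputs and vertex sets as outputs -/

/-- `‖G‖ = |V(G)| + |E(G)|`. -/
noncomputable def graphSize {V : Type*} [Fintype V] (G : SimpleGraph V) : ℕ :=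
  Fintype.card V + G.edgeSet.ncard

open Classical in
/-- The neighbours of `v` in increasing order. -/
noncomputable def neighborList {n : ℕ} (G : SimpleGraph (Fin n)) (v : Fin n) : List ℕ :=
  ((List.finRange n).filter fun w => G.Adj v w).map Fin.val

/-- The adjacency list representation of a graph on the vertices `0, …, n - 1`: the number `n`,
followed, for each vertex in turn, by its degree and the sorted list of its neighbours. -/
noncomputable def adjacencyList {n : ℕ} (G : SimpleGraph (Fin n)) : List ℕ :=
  n :: (List.finRange n).flatMap fun v => (neighborList G v).length :: neighborList G v

/-- On input `G` the program `P` returns the vertex set `S`, i.e. it halts and outputs a list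
without repetitions of the elements of `S`. -/
def ReturnsVertexSet (P : RAM.Program) {n : ℕ} (G : SimpleGraph (Fin n))
    (S : Finset (Fin n)) : Prop :=
  ∃ out : List ℕ, RAM.Outputs P (adjacencyList G) out ∧ (out : Multiset ℕ) = S.val.map Fin.val

/-- The program runs in time `Õ(‖G‖)` on every graph `G`, with words of `O(log ‖G‖)` bits: there
are constants `C`, `d`, `κ` such that on every graph with at least one vertex it halts within
`C ‖G‖ (1 + ⌊log₂ ‖G‖⌋) ^ d` steps and all its words are below `(‖G‖ + 1) ^ κ`. -/
def RunsInSoftLinearTime (P : RAM.Program) : Prop :=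
  ∃ C d κ : ℕ, ∀ n : ℕ, 1 ≤ n → ∀ G : SimpleGraph (Fin n),
    RAM.RunsWithin P (adjacencyList G) ((graphSize G + 1) ^ κ)
      (C * graphSize G * (1 + Nat.log 2 (graphSize G)) ^ d)

/-! ### Random planting -/

open Classical in
/-- The distribution `𝒢(G, H)`: sample a uniformly random injection `φ : V(H) → V(G)` and add
to `G` the edges `{φ u, φ u'}` for all edges `{u, u'}` of `H`. -/
noncomputable def randomPlanting {V U : Type*} [Fintype V] [Fintype U]
    (G : SimpleGraph V) (H : SimpleGraph U) (h : Fintype.card U ≤ Fintype.card V) :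
    PMF (SimpleGraph V) :=
  haveI : Nonempty (U ↪ V) := Function.Embedding.nonempty_of_card_le h
  (PMF.uniformOfFintype (U ↪ V)).map fun φ => G ⊔ H.map φ

/-- `K(n, c, p) = (n / 5) (c / 3) ^ (2 + (2 / c) log₂ (2 / p))`. -/
noncomputable def cliqueBound (n : ℕ) (c p : ℝ) : ℝ :=
  (n : ℝ) / 5 * (c / 3) ^ (2 + 2 / c * Real.logb 2 (2 / p))

/-!
Call the vertices not adjacent to `v`, including `v`, its non-neighbours. In `G` every vertex has at
least `p n` of them. Planting a clique on a random set `S` of `k ≈ c n` vertices changes nothing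
for a vertex outside `S`, while a member of `S` loses its non-neighbours in `S`, which is with high
probability more than half of the expected share `k / n` of all of them. So planting the clique
divides the number of non-neighbours of the members of `S` by more than `1 + c / 2`.

Let `L τ` be the set of vertices with at most `τ` non-neighbours in `G`, and consider the thresholds
`τ i = p n (1 + c / 2) ^ i / (1 + c / 2)`. The set `L (τ 0)` is empty, and `L (τ i)` consists of all
vertices for some `i ≤ (2 / c) log (2 / p)`; hence for some `i` the set `L (τ (i + 1))` is at least
`3 / c` times as large as `L (τ i)` and has at least `(c / 3) ^ ((2 / c) log (2 / p)) n` elements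
(`exists_large_step`, `exists_threshold`). In the planted graph, the vertices with at most `τ i`
non-neighbours then comprise all members of `S ∩ L (τ (i + 1))`, whose number is nearly
`(c / 2) |L (τ (i + 1))|` or more, and besides members of `S` only vertices of `L (τ i)`, which are
fewer (`card_denseVertices_inter_le`).

The algorithm need not know `c`, `p` or the threshold. It goes through the vertices in the order of
decreasing degree and keeps a clique `C`: a vertex that is adjacent to all of `C` is added, any other
vertex is discarded together with a non-neighbour in `C`. As a discarded pair contains at most one
vertex of a given clique `T`, after the vertices of a set `P` have been processed `C` has at least
`|P ∩ T| - |P \ T|` elements (`Greedy.card_le`). The largest of the cliques that occur at the end of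
a degree class is the output.

This takes quadratic time, which is soft linear on the inputs that matter: as `c` is not below the
order of `1 / log n`, a graph with a planted clique has at least `n ^ 2 / log ^ 2 n` edges. On inputs
shorter than that the program stops after reading them (`cliqueProgram_spec`). It is written in a
small structured language, whose translation into machine instructions is proved correct together
with its running time and word size (`BigStep.reaches`).

The number of elements of `S` in a fixed set `A` is controlled by its exponential moment
(`sum_half_pow_card_inter_le`), which is computed by expanding `2 ^ |A \ S|` over the subsets of `A`
that avoid `S`; it is no larger than for independent sampling. The resulting tail bound
(`card_embedding_lowerTail_le`) is applied to the sets of non-neighbours and to `L (τ (i + 1))`.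
For these the hypothesis on `cliqueBound` makes the expected number at least of the order of
`n ^ (2 / 3) / log n` and of `a log n`, respectively.
-/

/-! ### A structured language on top of the random access machine -/

namespace RAM

/-- Registers and memory of the machine, without the program counter. -/
structure Store where
  reg : ℕ → ℕ
  mem : ℕ → ℕ

/-- The configuration with a given program counter and store. -/
def Store.at (s : Store) (l : ℕ) : Config := ⟨l, s.reg, s.mem⟩

/-- All registers and memory cells hold numbers below `W`. -/
def Store.Below (W : ℕ) (s : Store) : Prop := (∀ i, s.reg i < W) ∧ ∀ x, s.mem x < W

/-- Write `x` into register `i`. -/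
def Store.set (s : Store) (i x : ℕ) : Store := ⟨Function.update s.reg i x, s.mem⟩

/-- Write `x` into memory cell `y`. -/
def Store.write (s : Store) (y x : ℕ) : Store := ⟨s.reg, Function.update s.mem y x⟩

@[simp] theorem Store.reg_set (s : Store) (i x j : ℕ) :
    (s.set i x).reg j = if j = i then x else s.reg j := by
  simp [Store.set, Function.update_apply]

@[simp] theorem Store.mem_set (s : Store) (i x : ℕ) : (s.set i x).mem = s.mem := rfl

@[simp] theorem Store.reg_write (s : Store) (y x : ℕ) : (s.write y x).reg = s.reg := rfl

@[simp] theorem Store.mem_write (s : Store) (y x z : ℕ) :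
    (s.write y x).mem z = if z = y then x else s.mem z := by
  simp [Store.write, Function.update_apply]

/-- The effect of an instruction on the store; jumps have none. -/
def Instr.effect : Instr → Store → Store
  | .const i m, s => s.set i m
  | .copy i j, s => s.set i (s.reg j)
  | .add i j k, s => s.set i (s.reg j + s.reg k)
  | .sub i j k, s => s.set i (s.reg j - s.reg k)
  | .mul i j k, s => s.set i (s.reg j * s.reg k)
  | .div i j k, s => s.set i (s.reg j / s.reg k)
  | .load i j, s => s.set i (s.mem (s.reg j))
  | .store i j, s => s.write (s.reg i) (s.reg j)
  | .jump _, s => s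
  | .jumpLt _ _ _, s => s
  | .jumpEq _ _ _, s => s

/-- The instruction is not a jump, and it keeps a store of words below `W` below `W`. Only
constants, sums and products can create a word that is larger than all words of the store. -/
def Instr.Safe (W : ℕ) : Instr → Store → Prop
  | .const _ m, _ => m < W
  | .copy _ _, _ => True
  | .add _ j k, s => s.reg j + s.reg k < W
  | .sub _ _ _, _ => True
  | .mul _ j k, s => s.reg j * s.reg k < W
  | .div _ _ _, _ => True
  | .load _ _, _ => True
  | .store _ _, _ => True
  | .jump _, _ => False
  | .jumpLt _ _ _, _ => False
  | .jumpEq _ _ _, _ => False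

theorem Store.Below.set {W : ℕ} {s : Store} (h : s.Below W) {i x : ℕ} (hx : x < W) :
    (s.set i x).Below W :=
  ⟨fun j => by rw [Store.reg_set]; split_ifs <;> [exact hx; exact h.1 j], h.2⟩

theorem Store.Below.write {W : ℕ} {s : Store} (h : s.Below W) {y x : ℕ} (hx : x < W) :
    (s.write y x).Below W :=
  ⟨h.1, fun z => by rw [Store.mem_write]; split_ifs <;> [exact hx; exact h.2 z]⟩

theorem Instr.Safe.below {W : ℕ} {ins : Instr} {s : Store} (hs : ins.Safe W s)
    (h : s.Below W) : (ins.effect s).Below W := by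
  cases ins with
  | const i m => exact h.set hs
  | copy i j => exact h.set (h.1 j)
  | add i j k => exact h.set hs
  | sub i j k => exact h.set ((Nat.sub_le _ _).trans_lt (h.1 j))
  | mul i j k => exact h.set hs
  | div i j k => exact h.set ((Nat.div_le_self _ _).trans_lt (h.1 j))
  | load i j => exact h.set (h.2 _)
  | store i j => exact h.write (h.1 j)
  | jump l => exact hs.elim
  | jumpLt i j l => exact hs.elim
  | jumpEq i j l => exact hs.elim

theorem Instr.Safe.exec {W : ℕ} {ins : Instr} {s : Store} (hs : ins.Safe W s) (l : ℕ) :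
    ins.exec (s.at l) = (ins.effect s).at (l + 1) := by
  cases ins <;> first | rfl | exact hs.elim

/-- Structured commands: straight-line instructions, sequences, conditionals and loops. -/
inductive Cmd where
  | skip
  | op (ins : Instr)
  | seq (a b : Cmd)
  /-- if `R i < R j` then `a` else `b` -/
  | ifLt (i j : ℕ) (a b : Cmd)
  /-- if `R i = R j` then `a` else `b` -/
  | ifEq (i j : ℕ) (a b : Cmd)
  /-- while `R i < R j` do `a` -/
  | whileLt (i j : ℕ) (a : Cmd)

/-- Carry out a list of commands one after the other. -/
def Cmd.block : List Cmd → Cmd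
  | [] => .skip
  | c :: cs => .seq c (Cmd.block cs)

/-- The number of instructions a command is translated to. -/
def Cmd.size : Cmd → ℕ
  | .skip => 0
  | .op _ => 1
  | .seq a b => a.size + b.size
  | .ifLt _ _ a b => b.size + a.size + 2
  | .ifEq _ _ a b => b.size + a.size + 2
  | .whileLt _ _ a => a.size + 3

/-- The instructions for a command, for a program in which they start at position `o`. -/
def Cmd.compile : Cmd → ℕ → Program
  | .skip, _ => []
  | .op ins, _ => [ins]
  | .seq a b, o => a.compile o ++ b.compile (o + a.size)
  | .ifLt i j a b, o =>
      .jumpLt i j (o + b.size + 2) ::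
        (b.compile (o + 1) ++ .jump (o + b.size + a.size + 2) :: a.compile (o + b.size + 2))
  | .ifEq i j a b, o =>
      .jumpEq i j (o + b.size + 2) ::
        (b.compile (o + 1) ++ .jump (o + b.size + a.size + 2) :: a.compile (o + b.size + 2))
  | .whileLt i j a, o =>
      .jumpLt i j (o + 2) :: .jump (o + a.size + 3) :: (a.compile (o + 2) ++ [.jump o])

theorem Cmd.length_compile (c : Cmd) (o : ℕ) : (c.compile o).length = c.size := by
  induction c generalizing o <;> simp_all [Cmd.compile, Cmd.size] <;> omega

/-- `BigStep W c s t s'`: started in the store `s`, the command `c` ends after `t` machine steps in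
the store `s'`, and it creates no word that is not below `W`. -/
inductive BigStep (W : ℕ) : Cmd → Store → ℕ → Store → Prop
  | skip (s) : BigStep W .skip s 0 s
  | op {ins s} (h : ins.Safe W s) : BigStep W (.op ins) s 1 (ins.effect s)
  | seq {a b s t s' t' s''} (ha : BigStep W a s t s') (hb : BigStep W b s' t' s'') :
      BigStep W (.seq a b) s (t + t') s''
  | ifLt_pos {i j a b s t s'} (h : s.reg i < s.reg j) (ha : BigStep W a s t s') :
      BigStep W (.ifLt i j a b) s (1 + t) s'
  | ifLt_neg {i j a b s t s'} (h : ¬ s.reg i < s.reg j) (hb : BigStep W b s t s') :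
      BigStep W (.ifLt i j a b) s (1 + (t + 1)) s'
  | ifEq_pos {i j a b s t s'} (h : s.reg i = s.reg j) (ha : BigStep W a s t s') :
      BigStep W (.ifEq i j a b) s (1 + t) s'
  | ifEq_neg {i j a b s t s'} (h : ¬ s.reg i = s.reg j) (hb : BigStep W b s t s') :
      BigStep W (.ifEq i j a b) s (1 + (t + 1)) s'
  | while_neg {i j a s} (h : ¬ s.reg i < s.reg j) : BigStep W (.whileLt i j a) s (1 + 1) s
  | while_pos {i j a s t s' t' s''} (h : s.reg i < s.reg j) (ha : BigStep W a s t s')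
      (hw : BigStep W (.whileLt i j a) s' t' s'') :
      BigStep W (.whileLt i j a) s (1 + (t + (1 + t'))) s''

/-- `t` steps lead from `σ` to `τ`, through configurations with words below `W` only. -/
def Reaches (P : Program) (W : ℕ) (σ : Config) (t : ℕ) (τ : Config) : Prop :=
  (step P)^[t] σ = τ ∧ ∀ r ≤ t, Fits W ((step P)^[r] σ)

theorem Reaches.refl {P : Program} {W : ℕ} {σ : Config} (h : Fits W σ) : Reaches P W σ 0 σ :=
  ⟨rfl, fun r hr => by obtain rfl := Nat.le_zero.1 hr; exact h⟩

theorem Reaches.trans {P : Program} {W : ℕ} {σ τ υ : Config} {t t' : ℕ}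
    (h : Reaches P W σ t τ) (h' : Reaches P W τ t' υ) : Reaches P W σ (t + t') υ := by
  refine ⟨?_, fun r hr => ?_⟩
  · rw [add_comm, Function.iterate_add_apply, h.1, h'.1]
  · rcases le_total r t with hrt | hrt
    · exact h.2 r hrt
    · obtain ⟨u, rfl⟩ := Nat.exists_eq_add_of_le hrt
      rw [add_comm, Function.iterate_add_apply, h.1]
      exact h'.2 u (by omega)

/-- A single step, given the instruction at the current position. -/
theorem Reaches.single {P : Program} {W l : ℕ} {s s' : Store} {l' : ℕ} {ins : Instr}
    (hP : P[l]? = some ins) (h : s.Below W) (h' : s'.Below W)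
    (he : ins.exec (s.at l) = s'.at l') : Reaches P W (s.at l) 1 (s'.at l') := by
  have hstep : step P (s.at l) = s'.at l' := by
    rw [← he]
    unfold step
    rw [show (s.at l).pc = l from rfl, hP]
  refine ⟨hstep, fun r hr => ?_⟩
  interval_cases r
  · exact h
  · rw [Function.iterate_one, hstep]; exact h'

/-- `Q` stands in `P` at the positions `o, o + 1, …`. -/
def CodeAt (P Q : Program) (o : ℕ) : Prop := ∀ x, x < Q.length → P[o + x]? = Q[x]?

theorem CodeAt.left {P Q R : Program} {o : ℕ} (h : CodeAt P (Q ++ R) o) : CodeAt P Q o :=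
  fun x hx => by
    rw [h x (by rw [List.length_append]; omega), List.getElem?_append_left hx]

theorem CodeAt.right {P Q R : Program} {o : ℕ} (h : CodeAt P (Q ++ R) o) :
    CodeAt P R (o + Q.length) := fun x hx => by
  rw [add_assoc, h _ (by rw [List.length_append]; omega),
    List.getElem?_append_right (Nat.le_add_right _ _), Nat.add_sub_cancel_left]

theorem CodeAt.head {P Q : Program} {ins : Instr} {o : ℕ} (h : CodeAt P (ins :: Q) o) :
    P[o]? = some ins := by
  have := h 0 (by simp)
  simpa using this

theorem CodeAt.tail {P Q : Program} {ins : Instr} {o : ℕ} (h : CodeAt P (ins :: Q) o) :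
    CodeAt P Q (o + 1) :=
  CodeAt.right (Q := [ins]) h

/-- The translation of structured commands is correct. -/
theorem BigStep.reaches {W : ℕ} {c : Cmd} {s s' : Store} {t : ℕ} (hc : BigStep W c s t s')
    {P : Program} {o : ℕ} (hP : CodeAt P (c.compile o) o) (hs : s.Below W) :
    s'.Below W ∧ Reaches P W (s.at o) t (s'.at (o + c.size)) := by
  induction hc generalizing o with
  | skip s => exact ⟨hs, Reaches.refl hs⟩
  | op h =>
    exact ⟨h.below hs, Reaches.single hP.head hs (h.below hs) (h.exec o)⟩
  | @seq a b s t s' t' s'' ha hb iha ihb =>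
    have ra := iha hP.left hs
    have hPb : CodeAt P (b.compile (o + a.size)) (o + a.size) := by
      have := hP.right
      rwa [Cmd.length_compile] at this
    have rb := ihb hPb ra.1
    rw [add_assoc] at rb
    exact ⟨rb.1, ra.2.trans rb.2⟩
  | @ifLt_pos i j a b s t s' h ha iha =>
    have h1 : Reaches P W (s.at o) 1 (s.at (o + b.size + 2)) :=
      Reaches.single hP.head hs hs (by simp [Instr.exec, Store.at, h])
    have hPa : CodeAt P (a.compile (o + b.size + 2)) (o + b.size + 2) := by
      have := hP.tail.right.tail
      rw [Cmd.length_compile] at this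
      convert this using 1; ring
    have ra := iha hPa hs
    refine ⟨ra.1, ?_⟩
    convert h1.trans ra.2 using 2
    simp only [Cmd.size]; ring
  | @ifLt_neg i j a b s t s' h hb ihb =>
    have h1 : Reaches P W (s.at o) 1 (s.at (o + 1)) :=
      Reaches.single hP.head hs hs (by simp [Instr.exec, Store.at, h])
    have rb := ihb hP.tail.left hs
    have hj := hP.tail.right.head
    rw [Cmd.length_compile] at hj
    have h2 : Reaches P W (s'.at (o + 1 + b.size)) 1 (s'.at (o + b.size + a.size + 2)) :=
      Reaches.single hj rb.1 rb.1 rfl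
    refine ⟨rb.1, ?_⟩
    convert h1.trans (rb.2.trans h2) using 2
    simp only [Cmd.size]; ring
  | @ifEq_pos i j a b s t s' h ha iha =>
    have h1 : Reaches P W (s.at o) 1 (s.at (o + b.size + 2)) :=
      Reaches.single hP.head hs hs (by simp [Instr.exec, Store.at, h])
    have hPa : CodeAt P (a.compile (o + b.size + 2)) (o + b.size + 2) := by
      have := hP.tail.right.tail
      rw [Cmd.length_compile] at this
      convert this using 1; ring
    have ra := iha hPa hs
    refine ⟨ra.1, ?_⟩
    convert h1.trans ra.2 using 2
    simp only [Cmd.size]; ring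
  | @ifEq_neg i j a b s t s' h hb ihb =>
    have h1 : Reaches P W (s.at o) 1 (s.at (o + 1)) :=
      Reaches.single hP.head hs hs (by simp [Instr.exec, Store.at, h])
    have rb := ihb hP.tail.left hs
    have hj := hP.tail.right.head
    rw [Cmd.length_compile] at hj
    have h2 : Reaches P W (s'.at (o + 1 + b.size)) 1 (s'.at (o + b.size + a.size + 2)) :=
      Reaches.single hj rb.1 rb.1 rfl
    refine ⟨rb.1, ?_⟩
    convert h1.trans (rb.2.trans h2) using 2
    simp only [Cmd.size]; ring
  | @while_neg i j a s h =>
    have h1 : Reaches P W (s.at o) 1 (s.at (o + 1)) :=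
      Reaches.single hP.head hs hs (by simp [Instr.exec, Store.at, h])
    have h2 : Reaches P W (s.at (o + 1)) 1 (s.at (o + a.size + 3)) :=
      Reaches.single hP.tail.head hs hs rfl
    exact ⟨hs, h1.trans h2⟩
  | @while_pos i j a s t s' t' s'' h ha hw iha ihw =>
    have h1 : Reaches P W (s.at o) 1 (s.at (o + 2)) :=
      Reaches.single hP.head hs hs (by simp [Instr.exec, Store.at, h])
    have ra := iha hP.tail.tail.left hs
    have hj := hP.tail.tail.right.head
    rw [Cmd.length_compile] at hj
    have h2 : Reaches P W (s'.at (o + 2 + a.size)) 1 (s'.at o) :=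
      Reaches.single hj ra.1 ra.1 rfl
    have rw' := ihw hP ra.1
    exact ⟨rw'.1, h1.trans (ra.2.trans (h2.trans rw'.2))⟩

/-- Total correctness with running time: `c`, started in `s`, ends after some number `t` of steps in
some store `s'` with `Q t s'`. -/
def WP (W : ℕ) (c : Cmd) (s : Store) (Q : ℕ → Store → Prop) : Prop :=
  ∃ t s', BigStep W c s t s' ∧ Q t s'

theorem WP.mono {W : ℕ} {c : Cmd} {s : Store} {Q Q' : ℕ → Store → Prop} (h : WP W c s Q)
    (hQ : ∀ t s', Q t s' → Q' t s') : WP W c s Q' := by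
  obtain ⟨t, s', hb, hq⟩ := h
  exact ⟨t, s', hb, hQ _ _ hq⟩

theorem wp_skip {W : ℕ} {s : Store} {Q : ℕ → Store → Prop} : WP W .skip s Q ↔ Q 0 s :=
  ⟨fun ⟨_, _, hb, hq⟩ => by cases hb; exact hq, fun h => ⟨_, _, .skip s, h⟩⟩

theorem wp_op {W : ℕ} {ins : Instr} {s : Store} {Q : ℕ → Store → Prop} :
    WP W (.op ins) s Q ↔ ins.Safe W s ∧ Q 1 (ins.effect s) :=
  ⟨fun ⟨_, _, hb, hq⟩ => by cases hb with | op h => exact ⟨h, hq⟩,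
    fun h => ⟨_, _, .op h.1, h.2⟩⟩

theorem wp_seq {W : ℕ} {a b : Cmd} {s : Store} {Q : ℕ → Store → Prop} :
    WP W (.seq a b) s Q ↔ WP W a s fun t s' => WP W b s' fun t' s'' => Q (t + t') s'' := by
  constructor
  · rintro ⟨_, _, hb, hq⟩
    cases hb with | seq ha hb => exact ⟨_, _, ha, _, _, hb, hq⟩
  · rintro ⟨_, _, ha, _, _, hb, hq⟩
    exact ⟨_, _, .seq ha hb, hq⟩

theorem wp_block_nil {W : ℕ} {s : Store} {Q : ℕ → Store → Prop} :
    WP W (.block []) s Q ↔ Q 0 s := wp_skip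

theorem wp_block_cons {W : ℕ} {c : Cmd} {cs : List Cmd} {s : Store} {Q : ℕ → Store → Prop} :
    WP W (.block (c :: cs)) s Q ↔
      WP W c s fun t s' => WP W (.block cs) s' fun t' s'' => Q (t + t') s'' := wp_seq

theorem wp_ifLt {W : ℕ} {i j : ℕ} {a b : Cmd} {s : Store} {Q : ℕ → Store → Prop}
    (ha : s.reg i < s.reg j → WP W a s fun t s' => Q (1 + t) s')
    (hb : ¬ s.reg i < s.reg j → WP W b s fun t s' => Q (1 + (t + 1)) s') :
    WP W (.ifLt i j a b) s Q := by
  by_cases h : s.reg i < s.reg j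
  · obtain ⟨t, s', hr, hq⟩ := ha h
    exact ⟨_, _, .ifLt_pos h hr, hq⟩
  · obtain ⟨t, s', hr, hq⟩ := hb h
    exact ⟨_, _, .ifLt_neg h hr, hq⟩

theorem wp_ifEq {W : ℕ} {i j : ℕ} {a b : Cmd} {s : Store} {Q : ℕ → Store → Prop}
    (ha : s.reg i = s.reg j → WP W a s fun t s' => Q (1 + t) s')
    (hb : ¬ s.reg i = s.reg j → WP W b s fun t s' => Q (1 + (t + 1)) s') :
    WP W (.ifEq i j a b) s Q := by
  by_cases h : s.reg i = s.reg j
  · obtain ⟨t, s', hr, hq⟩ := ha h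
    exact ⟨_, _, .ifEq_pos h hr, hq⟩
  · obtain ⟨t, s', hr, hq⟩ := hb h
    exact ⟨_, _, .ifEq_neg h hr, hq⟩

/-- The rule for a loop that is carried out exactly `N` times. The invariant `I k t s` speaks of
the store `s` and the time `t` spent in the loop after `k` rounds. -/
theorem wp_while {W : ℕ} {i j : ℕ} {a : Cmd} {s : Store} (N : ℕ) (I : ℕ → ℕ → Store → Prop)
    (h0 : I 0 0 s) (hN : ∀ t s', I N t s' → ¬ s'.reg i < s'.reg j)
    (hstep : ∀ k < N, ∀ t s', I k t s' →
      s'.reg i < s'.reg j ∧ WP W a s' fun t' s'' => I (k + 1) (t + t' + 2) s'') :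
    WP W (.whileLt i j a) s fun t s' => ∃ t', t = t' + 2 ∧ I N t' s' := by
  suffices H : ∀ m k t s', k + m = N → I k t s' →
      WP W (.whileLt i j a) s' fun t' s'' => ∃ u, t + t' = u + 2 ∧ I N u s'' by
    refine (H N 0 0 s (Nat.zero_add N) h0).mono ?_
    rintro t s' ⟨u, hu, hI⟩
    exact ⟨u, by omega, hI⟩
  intro m
  induction m with
  | zero =>
    rintro k t s' rfl hI
    exact ⟨_, _, .while_neg (hN _ _ hI), t, rfl, hI⟩
  | succ m ih =>
    intro k t s' hk hI
    obtain ⟨hlt, t1, s1, hb, hI1⟩ := hstep k (by omega) t s' hI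
    obtain ⟨t2, s2, hw, u, hu, hIN⟩ := ih (k + 1) _ _ (by omega) hI1
    exact ⟨_, _, .while_pos hlt hb hw, u, by omega, hIN⟩

end RAM

namespace RAM

/-- A loop with `N` rounds, each of at most `T` steps. -/
theorem wp_for {W : ℕ} {i j : ℕ} {a : Cmd} {s : Store} (N T : ℕ) (I : ℕ → Store → Prop)
    (h0 : I 0 s) (hN : ∀ s', I N s' → ¬ s'.reg i < s'.reg j)
    (hstep : ∀ k < N, ∀ s', I k s' →
      s'.reg i < s'.reg j ∧ WP W a s' fun t s'' => t ≤ T ∧ I (k + 1) s'') :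
    WP W (.whileLt i j a) s fun t s' => t ≤ N * (T + 2) + 2 ∧ I N s' := by
  refine (wp_while N (fun k t s' => t ≤ k * (T + 2) ∧ I k s') ⟨by simp, h0⟩
    (fun t s' h => hN s' h.2) ?_).mono ?_
  · rintro k hk t s' ⟨ht, hI⟩
    refine ⟨(hstep k hk s' hI).1, (hstep k hk s' hI).2.mono ?_⟩
    rintro t' s'' ⟨ht', hI'⟩
    exact ⟨by rw [Nat.succ_mul]; omega, hI'⟩
  · rintro t s' ⟨t', rfl, ht, hI⟩
    exact ⟨by omega, hI⟩

end RAM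

/-! ### The program -/

namespace CliqueProgram

open RAM RAM.Instr

/-- Registers `R 0, …, R 6` hold `0`, `1`, the number `n` of vertices, the addresses of the
adjacency matrix, of the degrees and of the marks of the current clique, and `n * n`. -/
def setup : Cmd := .block
  [.op (const 1 1), .op (load 2 0), .op (mul 6 2 2), .op (add 3 6 1), .op (add 4 3 6),
    .op (add 5 4 2), .op (const 7 1), .op (const 8 0)]

/-- Enter the neighbours of the vertex `R 8` into row `R 11` of the adjacency matrix. -/
def decodeRow : Cmd := .whileLt 12 9 (.block
  [.op (load 13 7), .op (add 13 13 11), .op (store 13 1), .op (add 7 7 1), .op (add 12 12 1)])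

/-- Turn the adjacency lists into a matrix and an array of degrees. -/
def decode : Cmd := .whileLt 8 2 (.block
  [.op (load 9 7), .op (add 10 4 8), .op (store 10 9), .op (add 7 7 1), .op (mul 11 8 2),
    .op (add 11 11 3), .op (const 12 0), decodeRow, .op (add 8 8 1)])

/-- Compute a number `R 10` that is one more than the logarithm, rounded up, of `R 7`. -/
def logLoop : Cmd := .whileLt 9 7 (.block [.op (add 9 9 9), .op (add 10 10 1)])

/-- Let `R 12` be a member of the current clique that is not adjacent to the vertex `R 9`, or `n`
if there is none. -/
def findConflict : Cmd := .whileLt 13 2 (.block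
  [.op (add 14 11 13), .op (load 14 14), .op (add 15 5 13), .op (load 15 15),
    .ifLt 14 15 (.op (copy 12 13)) .skip, .op (add 13 13 1)])

/-- Process the vertex `R 9`: add it to the current clique, or discard it together with a member
of the current clique that is not adjacent to it. -/
def process : Cmd := .block
  [.op (mul 11 9 2), .op (add 11 11 3), .op (copy 12 2), .op (const 13 0), findConflict,
    .ifLt 12 2
      (.block [.op (add 14 5 12), .op (store 14 0), .op (sub 7 7 1)])
      (.block [.op (add 14 5 9), .op (store 14 1), .op (add 7 7 1)])]

/-- Process the vertices of degree `R 8`. -/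
def processDegree : Cmd := .whileLt 9 2 (.block
  [.op (add 10 4 9), .op (load 10 10), .ifEq 10 8 process .skip, .op (add 9 9 1)])

/-- Write the members of the current clique into the cells `1, 2, …`. -/
def writeClique : Cmd := .whileLt 12 2 (.block
  [.op (add 13 5 12), .op (load 13 13),
    .ifEq 13 1 (.block [.op (add 11 11 1), .op (store 11 12)]) .skip, .op (add 12 12 1)])

/-- Make the current clique the output. -/
def snapshot : Cmd := .block [.op (const 11 0), .op (const 12 0), writeClique, .op (store 0 11)]

/-- Process the vertices in the order of decreasing degree, and keep the largest clique that is the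
current one when all vertices of at least some degree have been processed. -/
def search : Cmd := .whileLt 0 8 (.block
  [.op (sub 8 8 1), .op (const 9 0), processDegree, .op (load 10 0), .ifLt 10 7 snapshot .skip])

/-- The whole algorithm. The quadratic time of the search is spent only on inputs that are long
enough for it. -/
def main : Cmd := .block
  [setup, decode, .op (const 9 1), .op (const 10 1), logLoop,
    .op (mul 11 10 10), .op (mul 11 11 7),
    .ifLt 11 6 .skip (.block [.op (store 0 0), .op (const 7 0), .op (copy 8 2), search])]

/-- The fixed contents of the registers `0, …, 6`. -/
structure Env (n : ℕ) (s : Store) : Prop where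
  zero : s.reg 0 = 0
  one : s.reg 1 = 1
  size : s.reg 2 = n
  matrix : s.reg 3 = n * n + 1
  degrees : s.reg 4 = n * n + 1 + n * n
  marks : s.reg 5 = n * n + 1 + n * n + n
  square : s.reg 6 = n * n

theorem Env.set {n : ℕ} {s : Store} (h : Env n s) {i : ℕ} (hi : 6 < i) (x : ℕ) :
    Env n (s.set i x) := by
  obtain ⟨h0, h1, h2, h3, h4, h5, h6⟩ := h
  constructor <;> rw [Store.reg_set, if_neg (by omega)] <;> assumption

theorem Env.write {n : ℕ} {s : Store} (h : Env n s) (y x : ℕ) : Env n (s.write y x) :=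
  ⟨h.zero, h.one, h.size, h.matrix, h.degrees, h.marks, h.square⟩

/-- The list `l` stands in the memory `m` from address `p` on. -/
def Seg (m : ℕ → ℕ) (p : ℕ) (l : List ℕ) : Prop := ∀ x, (h : x < l.length) → m (p + x) = l[x]

/-- The part of the input for one vertex, given the list of its neighbours. -/
def entry (nb : ℕ → List ℕ) (v : ℕ) : List ℕ := (nb v).length :: nb v

theorem row_add_lt {n u w : ℕ} (hu : u < n) (hw : w < n) : u * n + w < n * n := by
  nlinarith

theorem row_add_inj {n u w u' w' : ℕ} (hw : w < n) (hw' : w' < n)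
    (h : u * n + w = u' * n + w') : u = u' ∧ w = w' := by
  have h1 : (u * n + w) / n = u := by
    rw [mul_comm, Nat.mul_add_div (by omega), Nat.div_eq_of_lt hw, add_zero]
  have h2 : (u' * n + w') / n = u' := by
    rw [mul_comm, Nat.mul_add_div (by omega), Nat.div_eq_of_lt hw', add_zero]
  have : u = u' := by rw [← h1, h, h2]
  subst this
  exact ⟨rfl, by omega⟩

/-- The memory after the decoding of the first `v` adjacency lists: the adjacency matrix, the
degrees and the marks of the current clique, none of which are set yet. -/
structure Decoded (n : ℕ) (nb : ℕ → List ℕ) (v : ℕ) (m : ℕ → ℕ) : Prop where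
  matrix : ∀ u < n, ∀ w < n,
    m (n * n + 1 + (u * n + w)) = if u < v ∧ w ∈ nb u then 1 else 0
  degrees : ∀ u < v, m (n * n + 1 + n * n + u) = (nb u).length
  marks : ∀ u < n, m (n * n + 1 + n * n + n + u) = 0

section Decode

variable {W n : ℕ} {nb : ℕ → List ℕ}

theorem wp_decodeRow (hW : 3 * (n * n) + 4 * n + 10 < W) {s : Store} {p v : ℕ} {l : List ℕ}
    (hE : Env n s) (h7 : s.reg 7 = p) (h8 : s.reg 8 = v) (h9 : s.reg 9 = l.length)
    (h11 : s.reg 11 = v * n + (n * n + 1)) (h12 : s.reg 12 = 0) (hv : v < n)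
    (hseg : Seg s.mem p l) (hp : p + l.length ≤ n * n + 1) (hl : ∀ w ∈ l, w < n) :
    WP W decodeRow s fun t s' => t ≤ l.length * 7 + 2 ∧ Env n s' ∧ s'.reg 7 = p + l.length ∧
      s'.reg 8 = v ∧
      ∀ x, s'.mem x = if ∃ w ∈ l, x = v * n + (n * n + 1) + w then 1 else s.mem x := by
  refine (wp_for l.length 5 (fun k s' => Env n s' ∧ s'.reg 7 = p + k ∧ s'.reg 8 = v ∧
    s'.reg 9 = l.length ∧ s'.reg 11 = v * n + (n * n + 1) ∧ s'.reg 12 = k ∧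
    ∀ x, s'.mem x = if ∃ w ∈ l.take k, x = v * n + (n * n + 1) + w then 1 else s.mem x)
    ?_ ?_ ?_).mono ?_
  · exact ⟨hE, h7, h8, h9, h11, h12, by simp⟩
  · rintro s' ⟨-, -, -, h9, -, h12, -⟩
    omega
  · rintro k hk s' ⟨hE, h7, h8, h9, h11, h12, hm⟩
    refine ⟨by omega, ?_⟩
    have hread : s'.mem (p + k) = l[k] := by
      rw [hm, if_neg, hseg k hk]
      rintro ⟨w, -, hw⟩
      omega
    have hlk : l[k] < n := hl _ (List.getElem_mem hk)
    have := row_add_lt hv hlk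
    simp only [wp_block_cons, wp_block_nil, wp_op, Instr.Safe, Instr.effect, Store.reg_set,
      Store.mem_set, Store.reg_write]
    simp only [h7, h11, h12, hE.one, hread, Nat.reduceEqDiff, if_true, if_false,
      OfNat.one_ne_ofNat, true_and]
    refine ⟨by omega, by omega, by omega, by omega, ?_, by omega, h8, h9, fun x => ?_⟩
    · exact (((((hE.set (by omega) _).set (by omega) _).write _ _).set (by omega) _).set
        (by omega) _)
    · simp only [Store.mem_write, Store.mem_set, hm]
      rw [List.take_succ_eq_append_getElem hk]
      by_cases hx : x = l[k] + (v * n + (n * n + 1))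
      · rw [if_pos hx, if_pos]
        exact ⟨l[k], List.mem_append_right _ (List.mem_singleton_self _), by omega⟩
      · rw [if_neg hx]
        refine if_congr ?_ rfl rfl
        constructor
        · rintro ⟨w, hw, h⟩
          exact ⟨w, List.mem_append_left _ hw, h⟩
        · rintro ⟨w, hw, h⟩
          rcases List.mem_append.1 hw with hw | hw
          · exact ⟨w, hw, h⟩
          · rw [List.mem_singleton] at hw
            omega
  · rintro t s' ⟨ht, hE, h7, h8, -, -, -, hm⟩
    refine ⟨ht, hE, h7, h8, ?_⟩
    simpa using hm

theorem wp_decode (hW : 3 * (n * n) + 4 * n + 10 < W) {s : Store} {L : ℕ}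
    (hE : Env n s) (h7 : s.reg 7 = 1) (h8 : s.reg 8 = 0)
    (hseg : Seg s.mem 1 ((List.range n).flatMap (entry nb)))
    (hL : 1 + ((List.range n).flatMap (entry nb)).length = L) (hLn : L ≤ n * n + 1)
    (hnb : ∀ v < n, ∀ w ∈ nb v, w < n) (hz : ∀ x, L ≤ x → s.mem x = 0) :
    WP W decode s fun t s' => t ≤ 16 * L ∧ Env n s' ∧ s'.reg 7 = L ∧ Decoded n nb n s'.mem := by
  -- the time is charged to the cells of the input that `R 7` has passed
  refine (wp_while n (fun v t s' => Env n s' ∧ s'.reg 8 = v ∧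
    t + 16 ≤ 16 * s'.reg 7 ∧
    s'.reg 7 + (((List.range n).drop v).flatMap (entry nb)).length = L ∧
    Seg s'.mem (s'.reg 7) (((List.range n).drop v).flatMap (entry nb)) ∧
    Decoded n nb v s'.mem) ?_ ?_ ?_).mono ?_
  · refine ⟨hE, h8, by omega, by simpa [h7] using hL, by simpa [h7] using hseg, ?_, ?_, ?_⟩
    · intro u hu w hw
      simp [hz (n * n + 1 + (u * n + w)) (by omega)]
    · intro u hu; omega
    · intro u hu
      exact hz _ (by omega)
  · rintro t s' ⟨hE, h8, -⟩
    rw [h8, hE.size]; omega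
  · rintro v hv t s' ⟨hE, h8, ht, hlen, hseg, hD⟩
    refine ⟨by rw [h8, hE.size]; exact hv, ?_⟩
    generalize hp : s'.reg 7 = p at *
    have hdrop : (List.range n).drop v = v :: (List.range n).drop (v + 1) := by
      rw [List.drop_eq_getElem_cons (by simpa using hv)]; simp
    rw [hdrop, List.flatMap_cons] at hlen hseg
    set rest := ((List.range n).drop (v + 1)).flatMap (entry nb) with hrest
    simp only [entry, List.length_append, List.length_cons] at hlen
    have hread : s'.mem p = (nb v).length := by
      have := hseg 0 (by simp [entry])
      simpa [entry] using this
    have hsegl : ∀ x (h : x < (nb v).length), s'.mem (p + 1 + x) = (nb v)[x] := by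
      intro x h
      have := hseg (x + 1) (by simp [entry]; omega)
      rw [show p + 1 + x = p + (x + 1) by ring, this]
      simp [entry, h]
    have hsegr : ∀ x (h : x < rest.length),
        s'.mem (p + 1 + (nb v).length + x) = rest[x] := by
      intro x h
      have := hseg ((nb v).length + 1 + x) (by simp [entry]; omega)
      rw [show p + 1 + (nb v).length + x = p + ((nb v).length + 1 + x) by ring, this]
      rw [List.getElem_append_right (by simp [entry])]
      simp [entry]
    have hvn : v * n ≤ n * n := Nat.mul_le_mul_right _ hv.le
    simp only [wp_block_cons, wp_block_nil, wp_op, Instr.Safe, Instr.effect, Store.reg_set,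
      Store.mem_set, Store.reg_write]
    simp only [hp, h8, hE.one, hE.size, hE.matrix, hE.degrees, hread, Nat.reduceEqDiff, if_true,
      if_false, OfNat.one_ne_ofNat, true_and]
    refine ⟨by omega, by omega, by omega, by omega, by omega, ?_⟩
    refine (wp_decodeRow (p := p + 1) (v := v) (l := nb v) hW ?_ ?_ ?_ ?_ ?_ ?_ hv ?_ (by omega)
      (hnb v hv)).mono ?_
    · exact ((((((hE.set (by omega) _).set (by omega) _).write _ _).set (by omega) _).set
        (by omega) _).set (by omega) _).set (by omega) _
    · simp
    · simp [h8]
    · simp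
    · simp
    · simp
    · intro x hx
      simp only [Store.mem_set, Store.mem_write]
      rw [if_neg (by omega), hsegl x hx]
    · rintro t' s'' ⟨ht', hE', h7', h8', hm⟩
      simp only [Store.mem_set, Store.mem_write] at hm
      have hrow : ∀ w ∈ nb v, v * n + w < n * n := fun w hw => row_add_lt hv (hnb v hv w hw)
      have hfar : ∀ x, (x < n * n + 1 ∨ n * n + 1 + n * n ≤ x) →
          ¬ ∃ w ∈ nb v, x = v * n + (n * n + 1) + w := by
        rintro x hx ⟨w, hw, h⟩
        have := hrow w hw
        omega
      refine ⟨by rw [h8', hE'.one]; omega, hE'.set (by omega) _, ?_, ?_, ?_, ?_, ?_, ?_, ?_⟩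
      · simp [h8', hE'.one]
      · simp only [h7']; omega
      · simp only [h7']; omega
      · intro x hx
        rw [h7', hm, if_neg (hfar _ (by omega)), if_neg (by omega), hsegr x hx]
      · intro u hu w hw
        have huw := row_add_lt hu hw
        rw [hm, if_neg (show ¬ n * n + 1 + (u * n + w) = n * n + 1 + n * n + v by omega),
          hD.matrix u hu w hw]
        by_cases huv : u = v
        · subst huv
          by_cases hwu : w ∈ nb u
          · rw [if_pos ⟨w, hwu, by omega⟩, if_pos ⟨by omega, hwu⟩]
          · rw [if_neg, if_neg (by tauto), if_neg (by tauto)]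
            rintro ⟨w', hw', h⟩
            obtain rfl : w = w' := by omega
            exact hwu hw'
        · rw [if_neg]
          · refine if_congr ?_ rfl rfl
            constructor
            · rintro ⟨h1, h2⟩; exact ⟨by omega, h2⟩
            · rintro ⟨h1, h2⟩; exact ⟨by omega, h2⟩
          · rintro ⟨w', hw', h⟩
            exact huv (row_add_inj hw (hnb v hv w' hw') (by omega)).1
      · intro u hu
        rw [hm, if_neg (hfar _ (by omega))]
        by_cases huv : u = v
        · rw [if_pos (by omega), huv]
        · rw [if_neg (by omega), hD.degrees u (by omega)]
      · intro u hu
        rw [hm, if_neg (hfar _ (by omega)), if_neg (by omega), hD.marks u hu]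
  · rintro t s' ⟨t', rfl, hE, h8, ht, hlen, -, hD⟩
    have : s'.reg 7 = L := by
      rw [← hlen, List.drop_of_length_le (by simp)]; simp
    exact ⟨by omega, hE, this, hD⟩

theorem wp_setup (hW : 3 * (n * n) + 4 * n + 10 < W) {s : Store} (hn : s.mem 0 = n)
    (h0 : s.reg 0 = 0) :
    WP W setup s fun t s' => t = 8 ∧ Env n s' ∧ s'.reg 7 = 1 ∧ s'.reg 8 = 0 ∧
      s'.mem = s.mem := by
  simp only [setup, wp_block_cons, wp_block_nil, wp_op, Instr.Safe, Instr.effect, Store.reg_set,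
    Store.mem_set]
  simp only [h0, hn, Nat.reduceEqDiff, if_true, if_false, OfNat.ofNat_ne_one, OfNat.one_ne_ofNat,
    zero_ne_one, true_and, and_true]
  refine ⟨by omega, by omega, by omega, by omega, by omega, by omega, by omega, ?_⟩
  constructor <;> simp [h0]

theorem wp_logLoop {L : ℕ} (hW : 2 * L + 10 < W) {s : Store} (hE : Env n s)
    (h7 : s.reg 7 = L) (h9 : s.reg 9 = 1) (h10 : s.reg 10 = 1) :
    WP W logLoop s fun t s' => t ≤ 4 * Nat.clog 2 L + 2 ∧ Env n s' ∧ s'.reg 7 = L ∧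
      s'.reg 10 = Nat.clog 2 L + 1 ∧ s'.mem = s.mem := by
  have hlt : ∀ k, 2 ^ k < L ↔ k < Nat.clog 2 L := fun k => by
    rw [← not_le, ← not_le, Nat.clog_le_iff_le_pow (by norm_num)]
  refine (wp_for (Nat.clog 2 L) 2 (fun k s' => Env n s' ∧ s'.reg 7 = L ∧ s'.reg 9 = 2 ^ k ∧
    s'.reg 10 = k + 1 ∧ s'.mem = s.mem) ?_ ?_ ?_).mono ?_
  · exact ⟨hE, h7, h9, h10, rfl⟩
  · rintro s' ⟨-, h7, h9, -⟩
    rw [h7, h9, hlt]; omega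
  · rintro k hk s' ⟨hE, h7, h9, h10, hm⟩
    have hk' := (hlt k).2 hk
    have := Nat.lt_two_pow_self (n := k)
    refine ⟨by rw [h7, h9]; exact hk', ?_⟩
    simp only [wp_block_cons, wp_block_nil, wp_op, Instr.Safe, Instr.effect, Store.reg_set,
      Store.mem_set]
    simp only [h7, h9, h10, hE.one, Nat.reduceEqDiff, if_true, if_false, OfNat.one_ne_ofNat,
      true_and, hm]
    refine ⟨by omega, by omega, by omega, (hE.set (by omega) _).set (by omega) _, ?_, trivial⟩
    rw [pow_succ]; ring
  · rintro t s' ⟨ht, hE, h7, -, h10, hm⟩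
    exact ⟨by omega, hE, h7, h10, hm⟩

end Decode

end CliqueProgram

namespace CliqueProgram

open RAM RAM.Instr

/-! ### The greedy clique search -/

/-- `T` is a clique of the graph with neighbour lists `nb`. -/
def IsCliqueOf (nb : ℕ → List ℕ) (T : Finset ℕ) : Prop := ∀ x ∈ T, ∀ y ∈ T, x ≠ y → y ∈ nb x

/-- The state of the greedy search after the vertices of `P` have been processed: `C` is a clique,
and the other vertices of `P` fall into pairs of distinct non-adjacent vertices, which is recorded
in the form that no clique contains more than half of them. -/
structure Greedy (nb : ℕ → List ℕ) (P C : Finset ℕ) : Prop where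
  subset : C ⊆ P
  clique : IsCliqueOf nb C
  pairs : ∀ T, IsCliqueOf nb T → ((P \ C) ∩ T).card ≤ ((P \ C) \ T).card

variable {W n : ℕ} {nb : ℕ → List ℕ}

theorem Greedy.empty : Greedy nb ∅ ∅ :=
  ⟨le_rfl, fun x hx => by simp at hx, fun T _ => by simp⟩

theorem Greedy.push {P C : Finset ℕ} (h : Greedy nb P C) {v : ℕ} (hv : v ∉ P)
    (hsymm : ∀ x ∈ P, v ∈ nb x ↔ x ∈ nb v) (hadj : ∀ u ∈ C, u ∈ nb v) :
    Greedy nb (insert v P) (insert v C) := by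
  refine ⟨Finset.insert_subset_insert _ h.subset, ?_, fun T hT => ?_⟩
  · intro x hx y hy hxy
    rcases Finset.mem_insert.1 hx with rfl | hxC <;> rcases Finset.mem_insert.1 hy with rfl | hyC
    · exact absurd rfl hxy
    · exact hadj y hyC
    · exact (hsymm x (h.subset hxC)).2 (hadj x hxC)
    · exact h.clique x hxC y hyC hxy
  · have : insert v P \ insert v C = P \ C := by
      ext x
      simp only [Finset.mem_sdiff, Finset.mem_insert]
      constructor
      · tauto
      · rintro ⟨h1, h2⟩
        refine ⟨.inr h1, ?_⟩
        rintro (rfl | h3)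
        · exact hv h1
        · exact h2 h3
    rw [this]
    exact h.pairs T hT

theorem Greedy.discard {P C : Finset ℕ} (h : Greedy nb P C) {u v : ℕ} (hv : v ∉ P) (hu : u ∈ C)
    (hadj : u ∉ nb v) : Greedy nb (insert v P) (C.erase u) := by
  have huP := h.subset hu
  have huv : u ≠ v := fun e => hv (e ▸ huP)
  refine ⟨(Finset.erase_subset _ _).trans (h.subset.trans (Finset.subset_insert _ _)),
    fun x hx y hy => h.clique x (Finset.mem_of_mem_erase hx) y (Finset.mem_of_mem_erase hy),
    fun T hT => ?_⟩
  have hD : insert v P \ C.erase u = insert u (insert v (P \ C)) := by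
    ext x
    simp only [Finset.mem_sdiff, Finset.mem_insert, Finset.mem_erase]
    have hvC : v ∉ C := fun e => hv (h.subset e)
    by_cases h1 : x = u
    · subst h1; simp [huP]
    · by_cases h2 : x = v
      · subst h2; simp [hvC]
      · simp [h1, h2]
  have hv1 : v ∉ P \ C := fun e => hv (Finset.mem_sdiff.1 e).1
  have hu1 : u ∉ insert v (P \ C) := by simp [huv, hu]
  have ih := h.pairs T hT
  rw [hD]
  -- at least one of the two vertices of the new pair is outside the clique `T`
  by_cases huT : u ∈ T
  · have hvT : v ∉ T := fun hvT => hadj (hT v hvT u huT huv.symm)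
    rw [Finset.insert_inter_of_mem huT, Finset.insert_inter_of_notMem hvT,
      Finset.insert_sdiff_of_mem _ huT, Finset.insert_sdiff_of_notMem _ hvT,
      Finset.card_insert_of_notMem (by simp [hu]),
      Finset.card_insert_of_notMem (by simp [hv])]
    omega
  · rw [Finset.insert_inter_of_notMem huT, Finset.insert_sdiff_of_notMem _ huT,
      Finset.card_insert_of_notMem (fun e => hu1 (Finset.mem_sdiff.1 e).1)]
    have h1 : (insert v (P \ C) ∩ T).card ≤ ((P \ C) ∩ T).card + 1 := by
      by_cases hvT : v ∈ T
      · rw [Finset.insert_inter_of_mem hvT]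
        exact Finset.card_insert_le _ _
      · rw [Finset.insert_inter_of_notMem hvT]; omega
    have h2 : ((P \ C) \ T).card ≤ (insert v (P \ C) \ T).card :=
      Finset.card_le_card (Finset.sdiff_subset_sdiff (Finset.subset_insert _ _) le_rfl)
    omega

/-- The current clique is large if the processed vertices mostly belong to one clique. -/
theorem Greedy.card_le {P C T : Finset ℕ} (h : Greedy nb P C) (hT : IsCliqueOf nb T) :
    (P ∩ T).card ≤ C.card + (P \ T).card := by
  have h1 := h.pairs T hT
  have h2 : P ∩ T ⊆ C ∪ ((P \ C) ∩ T) := by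
    intro x
    simp only [Finset.mem_inter, Finset.mem_union, Finset.mem_sdiff]
    tauto
  have h3 : ((P \ C) \ T).card ≤ (P \ T).card :=
    Finset.card_le_card (Finset.sdiff_subset_sdiff Finset.sdiff_subset le_rfl)
  have h4 := (Finset.card_le_card h2).trans (Finset.card_union_le _ _)
  omega

/-- The memory during the search, with the current clique `C`. -/
structure Working (n : ℕ) (nb : ℕ → List ℕ) (C : Finset ℕ) (m : ℕ → ℕ) : Prop where
  matrix : ∀ u < n, ∀ w < n, m (n * n + 1 + (u * n + w)) = if w ∈ nb u then 1 else 0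
  degrees : ∀ u < n, m (n * n + 1 + n * n + u) = (nb u).length
  marks : ∀ u < n, m (n * n + 1 + n * n + n + u) = if u ∈ C then 1 else 0

/-- A change of the memory below the adjacency matrix does not matter. -/
theorem Working.congr {C : Finset ℕ} {m m' : ℕ → ℕ} (h : Working n nb C m)
    (hm : ∀ x, n * n + 1 ≤ x → m' x = m x) : Working n nb C m' :=
  ⟨fun u hu w hw => by rw [hm _ (by omega), h.matrix u hu w hw],
    fun u hu => by rw [hm _ (by omega), h.degrees u hu],
    fun u hu => by rw [hm _ (by omega), h.marks u hu]⟩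

theorem Working.mark {C C' : Finset ℕ} {m m' : ℕ → ℕ} (h : Working n nb C m) {u b : ℕ}
    (hb : b = if u ∈ C' then 1 else 0) (hC : ∀ x, x ≠ u → (x ∈ C' ↔ x ∈ C))
    (hm : ∀ x, m' x = if x = n * n + 1 + n * n + n + u then b else m x) :
    Working n nb C' m' := by
  refine ⟨fun x hx w hw => ?_, fun x hx => ?_, fun x hx => ?_⟩
  · have := row_add_lt hx hw
    rw [hm, if_neg (by omega), h.matrix x hx w hw]
  · rw [hm, if_neg (by omega), h.degrees x hx]
  · rw [hm]
    by_cases hxu : x = u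
    · rw [if_pos (by omega), hb, hxu]
    · rw [if_neg (by omega), h.marks x hx]
      exact if_congr (hC x hxu).symm rfl rfl

theorem wp_findConflict (hW : 3 * (n * n) + 4 * n + 10 < W) {s : Store} {v : ℕ} {C : Finset ℕ}
    (hE : Env n s) (hv : v < n) (hC : C ⊆ Finset.range n) (hm : Working n nb C s.mem)
    (h11 : s.reg 11 = v * n + (n * n + 1)) (h12 : s.reg 12 = n) (h13 : s.reg 13 = 0) :
    WP W findConflict s fun t s' => t ≤ n * 9 + 2 ∧ Env n s' ∧ s'.mem = s.mem ∧
      s'.reg 7 = s.reg 7 ∧ s'.reg 8 = s.reg 8 ∧ s'.reg 9 = s.reg 9 ∧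
      ((s'.reg 12 < n ∧ s'.reg 12 ∈ C ∧ s'.reg 12 ∉ nb v) ∨
        (s'.reg 12 = n ∧ ∀ u ∈ C, u ∈ nb v)) := by
  refine (wp_for n 7 (fun k s' => Env n s' ∧ s'.mem = s.mem ∧
      s'.reg 7 = s.reg 7 ∧ s'.reg 8 = s.reg 8 ∧ s'.reg 9 = s.reg 9 ∧
      s'.reg 11 = v * n + (n * n + 1) ∧ s'.reg 13 = k ∧
      ((s'.reg 12 < n ∧ s'.reg 12 ∈ C ∧ s'.reg 12 ∉ nb v) ∨
        (s'.reg 12 = n ∧ ∀ u ∈ C, u < k → u ∈ nb v))) ?_ ?_ ?_).mono ?_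
  · exact ⟨hE, rfl, rfl, rfl, rfl, h11, h13, .inr ⟨h12, fun u _ h => by omega⟩⟩
  · rintro s' ⟨hE, -, -, -, -, -, h13, -⟩
    rw [h13, hE.size]; omega
  · rintro k hk s' ⟨hE, hmem, h7, h8, h9, h11, h13, h12⟩
    refine ⟨by rw [h13, hE.size]; exact hk, ?_⟩
    have hr := row_add_lt hv hk
    have e1 : v * n + (n * n + 1) + k = n * n + 1 + (v * n + k) := by ring
    simp only [wp_block_cons, wp_block_nil, wp_op, Instr.Safe, Instr.effect, Store.reg_set,
      Store.mem_set]
    simp only [h11, h13, hE.marks, hmem, Nat.reduceEqDiff, if_true, if_false, true_and,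
      e1, hm.matrix v hv k hk, hm.marks k hk]
    refine ⟨by omega, by omega, ?_⟩
    have hE4 : ∀ a b c d, Env n ((((s'.set 14 a).set 14 b).set 15 c).set 15 d) :=
      fun a b c d => (((hE.set (by omega) _).set (by omega) _).set (by omega) _).set (by omega) _
    apply wp_ifLt
    · intro hlt
      have hkC : k ∈ C ∧ k ∉ nb v := by
        simp only [Store.reg_set, Nat.reduceEqDiff, if_true, if_false] at hlt
        split_ifs at hlt <;> first | omega | exact ⟨by assumption, by assumption⟩
      simp only [wp_op, Instr.Safe, Instr.effect, Store.reg_set, Store.mem_set, Nat.reduceEqDiff,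
        if_true, if_false, true_and, hE.one, OfNat.one_ne_ofNat, h7, h8, h9, h11, h13, hmem]
      refine ⟨by omega, by omega, ?_, .inl ⟨hk, hkC⟩⟩
      exact ((hE4 _ _ _ _).set (by omega) _).set (by omega) _
    · intro hlt
      have hkC : k ∈ C → k ∈ nb v := by
        simp only [Store.reg_set, Nat.reduceEqDiff, if_true, if_false] at hlt
        intro h1
        by_contra h2
        simp [h1, h2] at hlt
      simp only [wp_skip, Store.reg_set, Store.mem_set, Nat.reduceEqDiff, if_false, true_and,
        hE.one, OfNat.one_ne_ofNat, h7, h8, h9,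
        h11, h13, hmem]
      refine ⟨by omega, by omega, (hE4 _ _ _ _).set (by omega) _, ?_⟩
      rcases h12 with h | ⟨h, h'⟩
      · exact .inl h
      · refine .inr ⟨h, fun u hu huk => ?_⟩
        rcases Nat.lt_succ_iff_lt_or_eq.1 huk with h1 | h1
        · exact h' u hu h1
        · rw [h1] at hu ⊢; exact hkC hu
  · rintro t s' ⟨ht, hE, hmem, h7, h8, h9, -, -, h⟩
    refine ⟨ht, hE, hmem, h7, h8, h9, h.imp id fun h => ⟨h.1, fun u hu => ?_⟩⟩
    exact h.2 u hu (Finset.mem_range.1 (hC hu))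

theorem wp_process (hW : 3 * (n * n) + 4 * n + 10 < W) {s : Store} {v : ℕ} {P C : Finset ℕ}
    (hsymm : ∀ x < n, ∀ y < n, x ∈ nb y ↔ y ∈ nb x)
    (hE : Env n s) (hv : v < n) (hP : P ⊆ Finset.range n) (hvP : v ∉ P) (hG : Greedy nb P C)
    (hm : Working n nb C s.mem) (h7 : s.reg 7 = C.card) (h9 : s.reg 9 = v) :
    WP W process s fun t s' => t ≤ n * 9 + 11 ∧ Env n s' ∧
      s'.reg 8 = s.reg 8 ∧ s'.reg 9 = v ∧ (∀ x < n * n + 1, s'.mem x = s.mem x) ∧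
      ∃ C', Greedy nb (insert v P) C' ∧ Working n nb C' s'.mem ∧ s'.reg 7 = C'.card := by
  have hvn : v * n ≤ n * n := Nat.mul_le_mul_right _ hv.le
  have hC : C ⊆ Finset.range n := hG.subset.trans hP
  have hCn : C.card ≤ n := by simpa using Finset.card_le_card hC
  simp only [process, wp_block_cons, wp_block_nil, wp_op, Instr.Safe, Instr.effect, Store.reg_set]
  simp only [h9, hE.size, hE.matrix, Nat.reduceEqDiff, if_true, if_false, true_and]
  refine ⟨by omega, by omega, by omega, ?_⟩
  refine (wp_findConflict (nb := nb) (v := v) (C := C) hW ?_ hv hC ?_ ?_ ?_ ?_).mono ?_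
  · exact (((hE.set (by omega) _).set (by omega) _).set (by omega) _).set (by omega) _
  · exact hm
  · simp
  · simp
  · simp
  rintro t s' ⟨ht, hE', hmem, h7', h8', h9', hf⟩
  simp only [Store.reg_set, Nat.reduceEqDiff, if_false, Store.mem_set, h9, h7] at h7' h8' h9' hmem
  have hmw : Working n nb C s'.mem := by rw [hmem]; exact hm
  apply wp_ifLt
  · intro hlt
    rw [hE'.size] at hlt
    obtain ⟨-, huC, hadj⟩ := hf.resolve_right (fun h => by omega)
    generalize hu : s'.reg 12 = u at *
    simp only [wp_block_cons, wp_block_nil, wp_op, Instr.Safe, Instr.effect, Store.reg_set,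
      Store.reg_write, Store.mem_set]
    simp only [hu, h7', h8', h9', hE'.zero, hE'.one, hE'.marks, Nat.reduceEqDiff, if_true, if_false,
      true_and, OfNat.zero_ne_ofNat, OfNat.one_ne_ofNat]
    refine ⟨by omega, by omega, ((hE'.set (by omega) _).write _ _).set (by omega) _, ?_,
      C.erase u, hG.discard hvP huC hadj, ?_, ?_⟩
    · intro x hx
      simp only [Store.mem_write, Store.mem_set, hmem]
      rw [if_neg (by omega)]
    · refine hmw.mark (u := u) (b := 0) (by simp) (fun x hx => by simp [hx]) fun x => ?_
      simp
    · rw [Finset.card_erase_of_mem huC]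
  · intro hlt
    rw [hE'.size] at hlt
    obtain ⟨-, hadj⟩ := hf.resolve_left (fun h => by omega)
    have hvC : v ∉ C := fun h => hvP (hG.subset h)
    simp only [wp_block_cons, wp_block_nil, wp_op, Instr.Safe, Instr.effect, Store.reg_set,
      Store.reg_write, Store.mem_set]
    simp only [h7', h8', h9', hE'.one, hE'.marks, Nat.reduceEqDiff, if_true, if_false,
      true_and, OfNat.one_ne_ofNat]
    refine ⟨by omega, by omega, by omega, ((hE'.set (by omega) _).write _ _).set (by omega) _, ?_,
      insert v C, hG.push hvP (fun x hx => ?_) hadj, ?_, ?_⟩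
    · intro x hx
      simp only [Store.mem_write, Store.mem_set, hmem]
      rw [if_neg (by omega)]
    · exact hsymm v hv x (Finset.mem_range.1 (hP hx))
    · refine hmw.mark (u := v) (b := 1) (by simp) (fun x hx => by simp [hx]) fun x => ?_
      simp
    · rw [Finset.card_insert_of_notMem hvC]

/-- The vertices of degree at least `d`. -/
def highDegree (n : ℕ) (nb : ℕ → List ℕ) (d : ℕ) : Finset ℕ :=
  (Finset.range n).filter fun u => d ≤ (nb u).length

/-- The vertices of degree `d` below `v`. -/
def degreeBelow (nb : ℕ → List ℕ) (d v : ℕ) : Finset ℕ :=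
  (Finset.range v).filter fun u => (nb u).length = d

theorem highDegree_succ_union (d : ℕ) :
    highDegree n nb (d + 1) ∪ degreeBelow nb d n = highDegree n nb d := by
  ext u
  simp only [highDegree, degreeBelow, Finset.mem_union, Finset.mem_filter, Finset.mem_range]
  constructor
  · rintro (⟨h1, h2⟩ | ⟨h1, h2⟩)
    · exact ⟨h1, by omega⟩
    · exact ⟨h1, by omega⟩
  · rintro ⟨h1, h2⟩
    rcases h2.lt_or_eq with h | h
    · exact .inl ⟨h1, by omega⟩
    · exact .inr ⟨h1, h.symm⟩

theorem card_highDegree_succ (d : ℕ) :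
    (highDegree n nb (d + 1)).card + (degreeBelow nb d n).card = (highDegree n nb d).card := by
  rw [← highDegree_succ_union d, Finset.card_union_of_disjoint]
  rw [Finset.disjoint_left]
  intro u h1 h2
  have h1 := (Finset.mem_filter.1 h1).2
  have h2 := (Finset.mem_filter.1 h2).2
  omega

theorem degreeBelow_succ (d v : ℕ) : degreeBelow nb d (v + 1) =
    if (nb v).length = d then insert v (degreeBelow nb d v) else degreeBelow nb d v := by
  rw [degreeBelow, Finset.range_add_one, Finset.filter_insert]
  rfl

theorem wp_processDegree (hW : 3 * (n * n) + 4 * n + 10 < W) {s : Store} {d : ℕ} {C : Finset ℕ}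
    (hsymm : ∀ x < n, ∀ y < n, x ∈ nb y ↔ y ∈ nb x)
    (hE : Env n s) (hG : Greedy nb (highDegree n nb (d + 1)) C)
    (hm : Working n nb C s.mem) (h7 : s.reg 7 = C.card) (h8 : s.reg 8 = d) (h9 : s.reg 9 = 0) :
    WP W processDegree s fun t s' =>
      t ≤ n * 10 + (n * 9 + 11) * (degreeBelow nb d n).card + 2 ∧ Env n s' ∧
      s'.reg 8 = d ∧ (∀ x < n * n + 1, s'.mem x = s.mem x) ∧
      ∃ C', Greedy nb (highDegree n nb d) C' ∧ Working n nb C' s'.mem ∧ s'.reg 7 = C'.card := by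
  -- only the vertices of degree `d` cost linear time
  refine (wp_while n (fun v t s' => t ≤ v * 10 + (n * 9 + 11) * (degreeBelow nb d v).card ∧
      Env n s' ∧ s'.reg 8 = d ∧ s'.reg 9 = v ∧ (∀ x < n * n + 1, s'.mem x = s.mem x) ∧
      ∃ C', Greedy nb (highDegree n nb (d + 1) ∪ degreeBelow nb d v) C' ∧
        Working n nb C' s'.mem ∧ s'.reg 7 = C'.card) ?_ ?_ ?_).mono ?_
  · exact ⟨by omega, hE, h8, h9, fun _ _ => rfl, C, by simpa [degreeBelow] using hG, hm, h7⟩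
  · rintro t s' ⟨-, hE, -, h9, -⟩
    rw [h9, hE.size]; omega
  · rintro v hv t s' ⟨ht, hE, h8, h9, hmem, C, hG, hw, h7⟩
    refine ⟨by rw [h9, hE.size]; exact hv, ?_⟩
    simp only [wp_block_cons, wp_block_nil, wp_op, Instr.Safe, Instr.effect, Store.reg_set,
      Store.mem_set]
    simp only [h9, hE.degrees, Nat.reduceEqDiff, if_true, if_false, true_and, hw.degrees v hv]
    refine ⟨by omega, ?_⟩
    have hE2 : ∀ a b, Env n ((s'.set 10 a).set 10 b) :=
      fun a b => (hE.set (by omega) _).set (by omega) _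
    have hvD : v ∉ degreeBelow nb d v := by simp [degreeBelow]
    apply wp_ifEq
    · intro hd
      simp only [Store.reg_set, Nat.reduceEqDiff, if_true, if_false, h8] at hd
      have hvP : v ∉ highDegree n nb (d + 1) ∪ degreeBelow nb d v := by
        simp [hvD, highDegree, hd]
      refine (wp_process (v := v) (C := C) hW hsymm (hE2 _ _) hv ?_ hvP hG hw ?_ ?_).mono ?_
      · refine Finset.union_subset (Finset.filter_subset _ _)
          ((Finset.filter_subset _ _).trans ?_)
        intro x hx
        rw [Finset.mem_range] at *
        omega
      · simp [h7]
      · simp [h9]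
      · rintro t' s'' ⟨ht', hE', h8', h9', hmem', C', hG', hw', h7'⟩
        simp only [Store.reg_set, Nat.reduceEqDiff, if_false, h8, Store.mem_set] at h8' hmem'
        rw [degreeBelow_succ, if_pos hd, Finset.card_insert_of_notMem hvD, Finset.union_insert]
        refine ⟨by rw [h9', hE'.one]; omega, ?_, hE'.set (by omega) _, by simp [h8'],
          by simp [h9', hE'.one], fun x hx => (hmem' x hx).trans (hmem x hx),
          C', hG', hw', by simp [h7']⟩
        have := Nat.mul_add_one (n * 9 + 11) (degreeBelow nb d v).card
        omega
    · intro hd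
      simp only [Store.reg_set, Nat.reduceEqDiff, if_true, if_false, h8] at hd
      rw [degreeBelow_succ, if_neg hd, wp_skip]
      simp only [Store.reg_set, Nat.reduceEqDiff, if_false, h8, h9, h7, hE.one,
        OfNat.one_ne_ofNat, true_and]
      exact ⟨by omega, by omega, (hE2 _ _).set (by omega) _, hmem, C, hG, hw, rfl⟩
  · rintro t s' ⟨t', rfl, ht, hE, h8, -, hmem, h⟩
    rw [highDegree_succ_union] at h
    exact ⟨by omega, hE, h8, hmem, h⟩

/-- The output cells hold the elements of `S` in increasing order. -/
def OutputCells (n : ℕ) (S : Finset ℕ) (m : ℕ → ℕ) : Prop :=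
  (List.range (m 0)).map (fun x => m (x + 1)) = (List.range n).filter (· ∈ S)

theorem length_filter_range_le (S : Finset ℕ) (k : ℕ) :
    ((List.range k).filter (· ∈ S)).length ≤ k := by
  simpa using List.length_filter_le (· ∈ S) (List.range k)

theorem length_filter_range {S : Finset ℕ} (hS : S ⊆ Finset.range n) :
    ((List.range n).filter (· ∈ S)).length = S.card := by
  have h1 : ((List.range n).filter (· ∈ S)).toFinset = S := by
    ext x
    simp only [List.mem_toFinset, List.mem_filter, List.mem_range, decide_eq_true_eq]
    exact ⟨fun h => h.2, fun h => ⟨Finset.mem_range.1 (hS h), h⟩⟩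
  rw [← List.toFinset_card_of_nodup (List.nodup_range.filter _), h1]

theorem wp_snapshot (hW : 3 * (n * n) + 4 * n + 10 < W) {s : Store} {C : Finset ℕ}
    (hE : Env n s) (hm : Working n nb C s.mem) :
    WP W snapshot s fun t s' => t ≤ n * 8 + 5 ∧ Env n s' ∧ s'.reg 7 = s.reg 7 ∧
      s'.reg 8 = s.reg 8 ∧ Working n nb C s'.mem ∧ OutputCells n C s'.mem := by
  have hnn : n ≤ n * n := Nat.le_mul_self n
  simp only [snapshot, wp_block_cons, wp_block_nil, wp_op, Instr.Safe, Instr.effect]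
  refine ⟨by omega, by omega, ?_⟩
  refine (wp_for (s := (s.set 11 0).set 12 0) n 6 (fun k s' => Env n s' ∧
      s'.reg 7 = s.reg 7 ∧ s'.reg 8 = s.reg 8 ∧ s'.reg 12 = k ∧ Working n nb C s'.mem ∧
      s'.reg 11 = ((List.range k).filter (· ∈ C)).length ∧
      (List.range (s'.reg 11)).map (fun x => s'.mem (x + 1)) = (List.range k).filter (· ∈ C))
      ?_ ?_ ?_).mono ?_
  · exact ⟨(hE.set (by omega) _).set (by omega) _, by simp, by simp, by simp, hm, by simp, by simp⟩
  · rintro s' ⟨hE, -, -, h12, -⟩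
    rw [h12, hE.size]; omega
  · rintro k hk s' ⟨hE, h7, h8, h12, hw, h11, hout⟩
    refine ⟨by rw [h12, hE.size]; exact hk, ?_⟩
    have hlen := length_filter_range_le C k
    simp only [wp_block_cons, wp_block_nil, wp_op, Instr.Safe, Instr.effect, Store.reg_set,
      Store.mem_set]
    simp only [h12, hE.marks, Nat.reduceEqDiff, if_true, if_false, true_and, hw.marks k hk]
    refine ⟨by omega, ?_⟩
    have hE2 : ∀ a b, Env n ((s'.set 13 a).set 13 b) :=
      fun a b => (hE.set (by omega) _).set (by omega) _
    apply wp_ifEq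
    · intro hk1
      have hkC : k ∈ C := by
        by_contra h
        simp [h, hE.one] at hk1
      have hfil : (List.range (k + 1)).filter (· ∈ C) = (List.range k).filter (· ∈ C) ++ [k] := by
        rw [List.range_succ, List.filter_append]; simp [hkC]
      simp only [wp_block_cons, wp_block_nil, wp_op, Instr.Safe, Instr.effect, Store.reg_set,
        Store.reg_write]
      simp only [h7, h8, h12, hE.one, Nat.reduceEqDiff, if_true, if_false, true_and,
        OfNat.one_ne_ofNat]
      refine ⟨by omega, by omega, by omega,
        (((hE2 _ _).set (by omega) _).write _ _).set (by omega) _, hw.congr ?_, ?_, ?_⟩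
      · intro x hx
        simp only [Store.mem_write, Store.mem_set]
        rw [if_neg (by omega)]
      · rw [hfil, List.length_append, h11, List.length_singleton]
      · rw [hfil, List.range_succ, List.map_append, ← hout]
        congr 1
        · refine List.map_congr_left fun x hx => ?_
          rw [List.mem_range] at hx
          simp only [Store.mem_write, Store.mem_set]
          rw [if_neg (by omega)]
        · simp
    · intro hk1
      have hkC : k ∉ C := by
        intro h
        simp [h, hE.one] at hk1
      have hfil : (List.range (k + 1)).filter (· ∈ C) = (List.range k).filter (· ∈ C) := by
        rw [List.range_succ, List.filter_append]; simp [hkC]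
      rw [hfil, wp_skip]
      simp only [Store.reg_set, Store.mem_set, Nat.reduceEqDiff, if_false, h7, h8, h12,
        hE.one, OfNat.one_ne_ofNat, true_and]
      exact ⟨by omega, by omega, (hE2 _ _).set (by omega) _, hw, h11, hout⟩
  · rintro t s' ⟨ht, hE, h7, h8, -, hw, h11, hout⟩
    rw [hE.zero]
    refine ⟨trivial, by omega, hE.write _ _, h7, h8, hw.congr ?_, ?_⟩
    · intro x hx
      simp only [Store.mem_write]
      rw [if_neg (by omega)]
    · unfold OutputCells
      rw [← hout]
      simp

theorem wp_search (hW : 3 * (n * n) + 4 * n + 10 < W) {s : Store}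
    (hsymm : ∀ x < n, ∀ y < n, x ∈ nb y ↔ y ∈ nb x) (hdeg : ∀ x < n, (nb x).length < n)
    (hE : Env n s) (hm : Working n nb ∅ s.mem) (h7 : s.reg 7 = 0) (h8 : s.reg 8 = n)
    (h0 : s.mem 0 = 0) :
    WP W search s fun t s' => t ≤ 60 * (n * n) + 2 ∧
      ∃ S : Finset ℕ, S ⊆ Finset.range n ∧ IsCliqueOf nb S ∧ OutputCells n S s'.mem ∧
        ∀ d T, IsCliqueOf nb T →
          (highDegree n nb d ∩ T).card ≤ S.card + (highDegree n nb d \ T).card := by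
  have hhigh : ∀ d, n ≤ d → highDegree n nb d = ∅ := by
    intro d hd
    refine Finset.filter_eq_empty_iff.2 fun x hx => ?_
    have := hdeg x (Finset.mem_range.1 hx)
    omega
  -- before round `k` all vertices of degree at least `n - k` have been processed
  refine (wp_while n (fun k t s' =>
      t ≤ k * (n * 18 + 20) + (n * 9 + 11) * (highDegree n nb (n - k)).card ∧
      Env n s' ∧ s'.reg 8 = n - k ∧
      (∃ C, Greedy nb (highDegree n nb (n - k)) C ∧ Working n nb C s'.mem ∧ s'.reg 7 = C.card) ∧
      ∃ S : Finset ℕ, S ⊆ Finset.range n ∧ IsCliqueOf nb S ∧ OutputCells n S s'.mem ∧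
        ∀ d, n - k ≤ d → ∀ T, IsCliqueOf nb T →
          (highDegree n nb d ∩ T).card ≤ S.card + (highDegree n nb d \ T).card) ?_ ?_ ?_).mono ?_
  · refine ⟨by omega, hE, h8, ⟨∅, ?_, hm, by simpa using h7⟩, ∅, by simp,
      fun x hx => by simp at hx, by simp [OutputCells, h0], ?_⟩
    · rw [hhigh _ (by omega)]; exact Greedy.empty
    · intro d hd T _
      simp [hhigh d (by omega)]
  · rintro t s' ⟨-, hE, h8, -⟩
    rw [h8, hE.zero]; omega
  · rintro k hk t s' ⟨ht, hE, h8, ⟨C, hG, hw, h7⟩, S, hSn, hSc, hout, hS⟩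
    refine ⟨by rw [h8, hE.zero]; omega, ?_⟩
    obtain ⟨d, hd⟩ : ∃ d, n - k = d + 1 := ⟨n - k - 1, by omega⟩
    have hd' : n - (k + 1) = d := by omega
    rw [hd] at h8 hG ht hS
    rw [hd']
    simp only [wp_block_cons, wp_block_nil, wp_op, Instr.Safe, Instr.effect]
    simp only [h8, hE.one, true_and]
    refine ⟨by omega, ?_⟩
    refine (wp_processDegree (d := d) (C := C) hW hsymm
      ((hE.set (by omega) _).set (by omega) _) hG hw ?_ ?_ ?_).mono ?_
    · simp [h7]
    · simp
    · simp
    rintro t' s'' ⟨ht', hE', h8', hmem, C', hG', hw', h7'⟩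
    have hC'n : C' ⊆ Finset.range n := hG'.subset.trans (Finset.filter_subset _ _)
    simp only [Store.mem_set] at hmem
    have hout' : OutputCells n S s''.mem := by
      unfold OutputCells
      have hle : s'.mem 0 = S.card := by
        rw [← length_filter_range hSn, ← hout]; simp
      have hSn' : S.card ≤ n := by simpa using Finset.card_le_card hSn
      have := Nat.le_mul_self n
      rw [hmem 0 (by omega), ← hout]
      refine List.map_congr_left fun x hx => ?_
      rw [List.mem_range] at hx
      exact hmem _ (by omega)
    have hle : s''.mem 0 = S.card := by
      rw [← length_filter_range hSn, ← hout']; simp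
    have hcard := card_highDegree_succ (n := n) (nb := nb) d
    have hmul : (n * 9 + 11) * (highDegree n nb (d + 1)).card +
        (n * 9 + 11) * (degreeBelow nb d n).card = (n * 9 + 11) * (highDegree n nb d).card := by
      rw [← Nat.mul_add, hcard]
    have hsplit : ∀ d', d ≤ d' → d' = d ∨ d + 1 ≤ d' := fun d' h => by omega
    simp only [hE'.zero, hle]
    apply wp_ifLt
    · intro hlt
      simp only [Store.reg_set, Nat.reduceEqDiff, if_true, if_false, h7'] at hlt
      refine (wp_snapshot (C := C') hW (hE'.set (by omega) _) hw').mono ?_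
      rintro t'' s3 ⟨ht'', hE3, h73, h83, hw3, hout3⟩
      simp only [Store.reg_set, Nat.reduceEqDiff, if_false, h7', h8'] at h73 h83
      refine ⟨?_, hE3, h83, ⟨C', hG', hw3, h73⟩, C', hC'n, hG'.clique, hout3, ?_⟩
      · rw [Nat.succ_mul]; omega
      · intro d' hd' T hT
        rcases hsplit d' hd' with rfl | hd'
        · exact hG'.card_le hT
        · have := hS d' hd' T hT
          omega
    · intro hlt
      simp only [Store.reg_set, Nat.reduceEqDiff, if_true, if_false, h7'] at hlt
      rw [wp_skip]
      refine ⟨?_, hE'.set (by omega) _, by simp [h8'], ⟨C', hG', hw', by simp [h7']⟩,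
        S, hSn, hSc, hout', ?_⟩
      · rw [Nat.succ_mul]; omega
      · intro d' hd' T hT
        rcases hsplit d' hd' with rfl | hd'
        · have := hG'.card_le hT
          omega
        · exact hS d' hd' T hT
  · rintro t s' ⟨t', rfl, ht, -, -, -, S, hSn, hSc, hout, hS⟩
    refine ⟨?_, S, hSn, hSc, hout, fun d => hS d (by omega)⟩
    have h1 : (highDegree n nb (n - n)).card ≤ n :=
      (Finset.card_filter_le _ _).trans (by simp)
    have h2 := Nat.mul_le_mul_left (n * 9 + 11) h1
    have h3 := Nat.le_mul_self n
    have h4 : (n * 9 + 11) * n = 9 * (n * n) + 11 * n := by ring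
    have h5 : n * (n * 18 + 20) = 18 * (n * n) + 20 * n := by ring
    omega

end CliqueProgram

namespace CliqueProgram

open RAM RAM.Instr

/-! ### The program on the adjacency list representation of a graph -/

theorem wp_main {W n L : ℕ} {nb : ℕ → List ℕ} (hn : 1 ≤ n)
    (hW : 3 * (n * n) + 4 * n + 10 < W)
    (hW' : (Nat.clog 2 L + 1) * (Nat.clog 2 L + 1) * L < W) {s : Store}
    (hs : s.reg 0 = 0) (hsn : s.mem 0 = n) (hseg : Seg s.mem 1 ((List.range n).flatMap (entry nb)))
    (hL : 1 + ((List.range n).flatMap (entry nb)).length = L) (hLn : L ≤ n * n + 1)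
    (hz : ∀ x, L ≤ x → s.mem x = 0) (hnb : ∀ v < n, ∀ w ∈ nb v, w < n)
    (hsymm : ∀ x < n, ∀ y < n, x ∈ nb y ↔ y ∈ nb x) (hdeg : ∀ x < n, (nb x).length < n) :
    WP W main s fun t s' =>
      t ≤ 16 * L + 4 * Nat.clog 2 L + 60 * ((Nat.clog 2 L + 1) * (Nat.clog 2 L + 1) * L) + 40 ∧
      (n * n ≤ (Nat.clog 2 L + 1) * (Nat.clog 2 L + 1) * L →
        ∃ S : Finset ℕ, S ⊆ Finset.range n ∧ IsCliqueOf nb S ∧ OutputCells n S s'.mem ∧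
          ∀ d T, IsCliqueOf nb T →
            (highDegree n nb d ∩ T).card ≤ S.card + (highDegree n nb d \ T).card) := by
  have hnn := Nat.mul_le_mul hn hn
  have hll : (Nat.clog 2 L + 1) * (Nat.clog 2 L + 1) < W :=
    (Nat.le_mul_of_pos_right _ (by omega)).trans_lt hW'
  simp only [main, wp_block_cons, wp_block_nil, wp_op, Instr.Safe, Instr.effect]
  refine (wp_setup hW hsn hs).mono ?_
  rintro t1 s1 ⟨rfl, hE1, h7, h8, hm1⟩
  rw [← hm1] at hseg hz
  refine (wp_decode (nb := nb) hW hE1 h7 h8 hseg hL hLn hnb hz).mono ?_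
  rintro t2 s2 ⟨ht2, hE2, h7, hD⟩
  refine ⟨by omega, by omega, ?_⟩
  refine (wp_logLoop (n := n) (L := L) (by omega) ((hE2.set (by omega) _).set (by omega) _)
    (by simpa using h7) (by simp) (by simp)).mono ?_
  rintro t3 s3 ⟨ht3, hE3, h7, h10, hm3⟩
  simp only [Store.reg_set, Nat.reduceEqDiff, if_true, if_false, h7, h10]
  refine ⟨hll, hW', ?_⟩
  have hE5 : ∀ a b, Env n ((s3.set 11 a).set 11 b) :=
    fun a b => (hE3.set (by omega) _).set (by omega) _
  set l := Nat.clog 2 L with hl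
  apply wp_ifLt
  · intro hlt
    simp only [Store.reg_set, Nat.reduceEqDiff, if_true, if_false, hE3.square] at hlt
    rw [wp_skip]
    exact ⟨by omega, fun h => by omega⟩
  · intro hlt
    simp only [Store.reg_set, Nat.reduceEqDiff, if_true, if_false, hE3.square] at hlt
    simp only [wp_block_cons, wp_block_nil, wp_op, Instr.Safe, Instr.effect, true_and]
    refine ⟨by omega, ?_⟩
    have hw : Working n nb ∅ s3.mem := by
      rw [hm3]
      refine ⟨fun u hu w hw => ?_, hD.degrees, fun u hu => by simpa using hD.marks u hu⟩
      rw [Store.mem_set, Store.mem_set, hD.matrix u hu w hw]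
      simp [hu]
    refine (wp_search (nb := nb) hW hsymm hdeg
      ((((hE5 _ _).write _ _).set (by omega) _).set (by omega) _)
      (hw.congr ?_) ?_ ?_ ?_).mono ?_
    · intro x hx
      simp only [Store.mem_write, Store.mem_set, Store.reg_set, Nat.reduceEqDiff, if_false,
        hE3.zero, OfNat.zero_ne_ofNat]
      rw [if_neg (by omega)]
    · simp
    · simp [hE3.size]
    · simp [hE3.zero]
    · rintro t4 s4 ⟨ht4, hS⟩
      exact ⟨by omega, fun _ => hS⟩

end CliqueProgram

/-- The neighbour lists of a graph, as a function of the vertex number. -/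
noncomputable def neighborLists {n : ℕ} (G : SimpleGraph (Fin n)) (v : ℕ) : List ℕ :=
  if h : v < n then neighborList G ⟨v, h⟩ else []

section Encoding

open CliqueProgram RAM

variable {n : ℕ} (G : SimpleGraph (Fin n))

theorem neighborLists_coe (v : Fin n) : neighborLists G v = neighborList G v := by
  simp [neighborLists]

theorem mem_neighborLists {v w : Fin n} : (w : ℕ) ∈ neighborLists G v ↔ G.Adj v w := by
  classical
  rw [neighborLists_coe, neighborList, List.mem_map]
  constructor
  · rintro ⟨x, hx, hxw⟩
    obtain rfl := Fin.val_injective hxw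
    simpa using (List.mem_filter.1 hx).2
  · intro h
    exact ⟨w, by simpa using h, rfl⟩

theorem lt_of_mem_neighborLists {v w : ℕ} (h : w ∈ neighborLists G v) : w < n := by
  classical
  unfold neighborLists at h
  split_ifs at h
  · obtain ⟨x, -, rfl⟩ := List.mem_map.1 h
    exact x.2
  · simp at h

open Classical in
theorem length_neighborLists (v : Fin n) : (neighborLists G v).length = G.degree v := by
  rw [neighborLists_coe, neighborList, List.length_map, ← SimpleGraph.card_neighborFinset_eq_degree,
    ← List.toFinset_card_of_nodup ((List.nodup_finRange n).filter _)]
  congr 1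
  ext w
  simp

theorem adjacencyList_eq :
    adjacencyList G = n :: (List.range n).flatMap (entry (neighborLists G)) := by
  classical
  rw [adjacencyList]
  congr 1
  rw [← List.map_coe_finRange_eq_range, List.flatMap_map]
  congr 1
  funext v
  simp only [entry, neighborLists_coe]

theorem length_adjacencyList : (adjacencyList G).length = 1 + n + 2 * G.edgeSet.ncard := by
  classical
  have h1 : 2 * G.edgeSet.ncard = ∑ v, G.degree v := by
    rw [G.sum_degrees_eq_twice_card_edges, ← SimpleGraph.coe_edgeFinset, Set.ncard_coe_finset]
  rw [h1, adjacencyList, List.length_cons, List.length_flatMap]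
  have h2 : ((List.finRange n).map fun v =>
      ((neighborList G v).length :: neighborList G v).length).sum = ∑ v, (G.degree v + 1) := by
    rw [Fin.sum_univ_def]
    congr 1
    refine List.map_congr_left fun v _ => ?_
    rw [List.length_cons, ← length_neighborLists, neighborLists_coe]
  rw [h2, Finset.sum_add_distrib]
  simp
  ring

theorem le_of_mem_adjacencyList {x : ℕ} (hx : x ∈ adjacencyList G) : x ≤ n := by
  classical
  rw [adjacencyList_eq, List.mem_cons, List.mem_flatMap] at hx
  rcases hx with rfl | ⟨v, hv, hx⟩
  · exact le_rfl
  · rw [List.mem_range] at hv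
    rcases List.mem_cons.1 hx with rfl | hx
    · have := length_neighborLists G ⟨v, hv⟩
      rw [this]
      exact (G.degree_lt_card_verts _).le.trans (by simp)
    · exact (lt_of_mem_neighborLists G hx).le

theorem isCliqueOf_map {T : Finset (Fin n)} (hT : G.IsClique (T : Set (Fin n))) :
    IsCliqueOf (neighborLists G) (T.map Fin.valEmbedding) := by
  intro x hx y hy hxy
  obtain ⟨x, hxT, rfl⟩ := Finset.mem_map.1 hx
  obtain ⟨y, hyT, rfl⟩ := Finset.mem_map.1 hy
  exact (mem_neighborLists G).2 (hT hxT hyT fun h => hxy (by rw [h]))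

open Classical in
theorem highDegree_eq_map (d : ℕ) : highDegree n (neighborLists G) d =
    (Finset.univ.filter fun v => d ≤ G.degree v).map Fin.valEmbedding := by
  ext x
  simp only [highDegree, Finset.mem_filter, Finset.mem_range, Finset.mem_map, Finset.mem_univ,
    true_and, Fin.valEmbedding_apply]
  constructor
  · rintro ⟨hx, h⟩
    exact ⟨⟨x, hx⟩, by rwa [← length_neighborLists], rfl⟩
  · rintro ⟨v, hv, rfl⟩
    exact ⟨v.2, by rwa [length_neighborLists]⟩

/-- The RAM program that computes a clique. -/
def cliqueProgram : Program := CliqueProgram.main.compile 0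

/-- The logarithm, as computed by the program, of the length of the input. -/
noncomputable def inputLog (G : SimpleGraph (Fin n)) : ℕ :=
  Nat.clog 2 (1 + n + 2 * G.edgeSet.ncard) + 1

open Classical in
/-- The program runs in soft linear time, and on dense enough inputs it returns a clique that is
large whenever, for some `d`, most vertices of degree at least `d` belong to one clique. -/
theorem cliqueProgram_spec (hn : 1 ≤ n) : ∃ t,
    t ≤ 3000 * graphSize G * (1 + Nat.log 2 (graphSize G)) ^ 2 ∧
    Halted cliqueProgram (run cliqueProgram (adjacencyList G) t) ∧
    (∀ r ≤ t, Fits ((graphSize G + 1) ^ 10) (run cliqueProgram (adjacencyList G) r)) ∧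
    (n * n ≤ inputLog G * inputLog G * (1 + n + 2 * G.edgeSet.ncard) →
      ∃ S : Finset (Fin n), G.IsClique (S : Set (Fin n)) ∧
        output (run cliqueProgram (adjacencyList G) t) =
          (List.range n).filter (· ∈ S.map Fin.valEmbedding) ∧
        ∀ d (T : Finset (Fin n)), G.IsClique (T : Set (Fin n)) →
          ((Finset.univ.filter fun v => d ≤ G.degree v) ∩ T).card ≤
            S.card + ((Finset.univ.filter fun v => d ≤ G.degree v) \ T).card) := by
  have hlen := length_adjacencyList G
  have hsize : graphSize G = n + G.edgeSet.ncard := by simp [graphSize]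
  unfold inputLog
  set L := 1 + n + 2 * G.edgeSet.ncard with hL
  set z := graphSize G with hz
  set W := (z + 1) ^ 10 with hWdef
  have hdeg : ∀ x < n, (neighborLists G x).length < n := fun x hx => by
    rw [length_neighborLists G ⟨x, hx⟩]
    simpa using G.degree_lt_card_verts ⟨x, hx⟩
  have hLn : L ≤ n * n + 1 := by
    have h1 : G.edgeSet.ncard ≤ n.choose 2 := by
      rw [← SimpleGraph.coe_edgeFinset, Set.ncard_coe_finset]
      simpa using G.card_edgeFinset_le_card_choose_two
    have h2 : 2 * n.choose 2 = n * (n - 1) := by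
      rw [Nat.choose_two_right, Nat.mul_div_cancel' (Nat.even_mul_pred_self n).two_dvd]
    have h3 : n * (n - 1) + n = n * n := by
      obtain ⟨m, rfl⟩ : ∃ m, n = m + 1 := ⟨n - 1, by omega⟩
      rw [Nat.add_sub_cancel]; ring
    omega
  have hclog : Nat.clog 2 L ≤ Nat.log 2 z + 3 := by
    rw [Nat.clog_le_iff_le_pow (by norm_num)]
    have := Nat.lt_pow_succ_log_self (b := 2) (by norm_num) z
    rw [Nat.succ_eq_add_one, pow_succ] at this
    rw [pow_add]
    omega
  have hlog : Nat.log 2 z ≤ z := Nat.log_le_self 2 z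
  have hl : Nat.clog 2 L + 1 ≤ 4 * (1 + Nat.log 2 z) := by omega
  have hz1 : 2 ≤ z + 1 := by omega
  have hpow : ∀ c k, k ≤ 8 → c ≤ 2 ^ (9 - k) → c * (z + 1) ^ k < W := by
    intro c k hk hc
    calc c * (z + 1) ^ k ≤ (z + 1) ^ (9 - k) * (z + 1) ^ k :=
          Nat.mul_le_mul_right _ (hc.trans (Nat.pow_le_pow_left hz1 _))
      _ = (z + 1) ^ 9 := by rw [← pow_add]; congr 1; omega
      _ < W := Nat.pow_lt_pow_right (by omega) (by norm_num)
  have hW : 3 * (n * n) + 4 * n + 10 < W := by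
    have h1 := hpow 17 2 (by norm_num) (by norm_num)
    have h2 : n * n ≤ (z + 1) ^ 2 := by rw [sq]; exact Nat.mul_le_mul (by omega) (by omega)
    have h3 : n + 1 ≤ (z + 1) ^ 2 := by nlinarith
    omega
  have hW' : (Nat.clog 2 L + 1) * (Nat.clog 2 L + 1) * L < W := by
    refine lt_of_le_of_lt ?_ (hpow 48 3 (by norm_num) (by norm_num))
    calc (Nat.clog 2 L + 1) * (Nat.clog 2 L + 1) * L
        ≤ (4 * (z + 1)) * (4 * (z + 1)) * (3 * (z + 1)) :=
          Nat.mul_le_mul (Nat.mul_le_mul (by omega) (by omega)) (by omega)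
      _ = 48 * (z + 1) ^ 3 := by ring
  set s : Store := ⟨fun _ => 0, fun x => (adjacencyList G).getD x 0⟩ with hs
  have hmem0 : s.mem 0 = n := by simp [hs, adjacencyList_eq]
  have hseg : Seg s.mem 1 ((List.range n).flatMap (entry (neighborLists G))) := by
    intro x hx
    simp only [hs, adjacencyList_eq]
    rw [add_comm, List.getD_cons_succ, List.getD_eq_getElem _ _ hx]
  have hL' : 1 + ((List.range n).flatMap (entry (neighborLists G))).length = L := by
    rw [← hlen, adjacencyList_eq, List.length_cons, add_comm]
  have hzero : ∀ x, L ≤ x → s.mem x = 0 := fun x hx =>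
    List.getD_eq_default _ _ (by omega)
  have hbelow : s.Below W := by
    refine ⟨fun i => by simp only [hs]; omega, fun x => ?_⟩
    simp only [hs]
    by_cases hx : x < (adjacencyList G).length
    · rw [List.getD_eq_getElem _ _ hx]
      have := le_of_mem_adjacencyList G (List.getElem_mem hx)
      omega
    · rw [List.getD_eq_default _ _ (by omega)]; omega
  obtain ⟨t, s', hbig, ht, hS⟩ := wp_main hn hW hW' (s := s) rfl hmem0 hseg hL' hLn hzero
    (fun v _ w hw => lt_of_mem_neighborLists G hw)
    (fun x hx y hy => by
      have h1 := mem_neighborLists G (v := ⟨y, hy⟩) (w := ⟨x, hx⟩)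
      have h2 := mem_neighborLists G (v := ⟨x, hx⟩) (w := ⟨y, hy⟩)
      exact h1.trans ((G.adj_comm _ _).trans h2.symm)) hdeg
  obtain ⟨-, hreach⟩ := hbig.reaches (P := cliqueProgram) (o := 0)
    (fun x _ => by rw [zero_add]; rfl) hbelow
  have hrun : run cliqueProgram (adjacencyList G) t = s'.at (0 + main.size) := hreach.1
  refine ⟨t, ?_, ?_, hreach.2, fun hdense => ?_⟩
  · have h1 : (Nat.clog 2 L + 1) * (Nat.clog 2 L + 1) * L ≤
        48 * (z * (1 + Nat.log 2 z) ^ 2) := by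
      calc _ ≤ (4 * (1 + Nat.log 2 z)) * (4 * (1 + Nat.log 2 z)) * (3 * z) :=
            Nat.mul_le_mul (Nat.mul_le_mul hl hl) (by omega)
        _ = _ := by ring
    have h2 : z ≤ z * (1 + Nat.log 2 z) ^ 2 := Nat.le_mul_of_pos_right _ (by positivity)
    rw [mul_assoc]
    omega
  · rw [hrun]
    show (main.compile 0).length ≤ 0 + main.size
    rw [Cmd.length_compile, zero_add]
  · obtain ⟨S, hSn, hSc, hout, hST⟩ := hS hdense
    set S' : Finset (Fin n) := Finset.univ.filter fun v => (v : ℕ) ∈ S with hS'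
    have hmap : S'.map Fin.valEmbedding = S := by
      ext x
      simp only [hS', Finset.mem_map, Finset.mem_filter, Finset.mem_univ, true_and,
        Fin.valEmbedding_apply]
      constructor
      · rintro ⟨v, hv, rfl⟩; exact hv
      · intro hx
        exact ⟨⟨x, Finset.mem_range.1 (hSn hx)⟩, hx, rfl⟩
    refine ⟨S', ?_, ?_, fun d T hT => ?_⟩
    · intro u hu v hv huv
      simp only [hS', Finset.coe_filter, Finset.mem_univ, true_and, Set.mem_ofPred_eq] at hu hv
      exact (mem_neighborLists G).1 (hSc u hu v hv fun h => huv (Fin.val_injective h))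
    · rw [hrun, hmap]
      exact hout
    · have := hST d _ (isCliqueOf_map G hT)
      rw [highDegree_eq_map, ← Finset.map_inter, ← Finset.map_sdiff, ← hmap, Finset.card_map,
        Finset.card_map, Finset.card_map] at this
      exact this

theorem cliqueProgram_runsInSoftLinearTime : RunsInSoftLinearTime cliqueProgram :=
  ⟨3000, 2, 10, fun n hn G => by
    obtain ⟨t, ht, hh, hf, -⟩ := cliqueProgram_spec G hn
    exact ⟨t, ht, hh, hf⟩⟩

open Classical in
theorem cliqueProgram_returns (hn : 1 ≤ n)
    (hdense : n * n ≤ inputLog G * inputLog G * (1 + n + 2 * G.edgeSet.ncard)) :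
    ∃ S : Finset (Fin n), ReturnsVertexSet cliqueProgram G S ∧ G.IsClique (S : Set (Fin n)) ∧
      ∀ d (T : Finset (Fin n)), G.IsClique (T : Set (Fin n)) →
        ((Finset.univ.filter fun v => d ≤ G.degree v) ∩ T).card ≤
          S.card + ((Finset.univ.filter fun v => d ≤ G.degree v) \ T).card := by
  obtain ⟨t, -, hh, -, hS⟩ := cliqueProgram_spec G hn
  obtain ⟨S, hSc, hout, hST⟩ := hS hdense
  refine ⟨S, ⟨_, ⟨t, hh, rfl⟩, ?_⟩, hSc, hST⟩
  rw [hout]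
  have hnd : ((List.range n).filter (· ∈ S.map Fin.valEmbedding)).Nodup := List.nodup_range.filter _
  refine Multiset.Nodup.ext (Multiset.coe_nodup.2 hnd) (S.map Fin.valEmbedding).nodup |>.2
    fun x => ?_
  rw [Multiset.mem_coe, List.mem_filter, Finset.mem_val, decide_eq_true_eq, List.mem_range]
  refine ⟨fun h => h.2, fun h => ⟨?_, h⟩⟩
  obtain ⟨v, -, rfl⟩ := Finset.mem_map.1 h
  exact v.2

end Encoding

/-! ### Random injections: a lower tail bound -/

section Tail

open Finset

variable {U V : Type*} [Fintype U] [Fintype V] [DecidableEq V]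

theorem descFactorial_sub_mul_pow_le (n k b : ℕ) :
    (n - k).descFactorial b * n ^ b ≤ (n - k) ^ b * n.descFactorial b := by
  induction b with
  | zero => simp
  | succ b ih =>
    rw [Nat.descFactorial_succ, Nat.descFactorial_succ, pow_succ, pow_succ]
    have h : (n - k - b) * n ≤ (n - k) * (n - b) := by
      rcases le_total (n - k) b with h | h
      · rw [Nat.sub_eq_zero_of_le h]; simp
      · rcases le_total n k with hk | hk
        · simp [Nat.sub_eq_zero_of_le hk]
        · obtain ⟨m, rfl⟩ := Nat.exists_eq_add_of_le hk
          simp only [Nat.add_sub_cancel_left] at h ⊢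
          obtain ⟨r, rfl⟩ := Nat.exists_eq_add_of_le h
          rw [Nat.add_sub_cancel_left, show k + (b + r) - b = k + r by omega]
          nlinarith
    calc (n - k - b) * (n - k).descFactorial b * (n ^ b * n)
        = ((n - k).descFactorial b * n ^ b) * ((n - k - b) * n) := by ring
      _ ≤ ((n - k) ^ b * n.descFactorial b) * ((n - k) * (n - b)) := Nat.mul_le_mul ih h
      _ = _ := by ring

open Classical in
theorem card_embedding_avoiding_le (B : Finset V) :
    (univ.filter fun φ : U ↪ V => Disjoint B (univ.map φ)).card ≤
      (Fintype.card V - B.card).descFactorial (Fintype.card U) := by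
  have h1 : Fintype.card (U ↪ {x // x ∉ B}) =
      (Fintype.card V - B.card).descFactorial (Fintype.card U) := by
    rw [Fintype.card_embedding_eq, Fintype.card_subtype_compl, Fintype.card_coe]
  rw [← h1, ← Fintype.card_subtype]
  have hmem : ∀ (φ : {φ : U ↪ V // Disjoint B (univ.map φ)}) (u : U), φ.1 u ∉ B := by
    rintro ⟨φ, hφ⟩ u hu
    exact Finset.disjoint_left.1 hφ hu (mem_map_of_mem φ (mem_univ u))
  refine Fintype.card_le_of_injective
    (fun φ => (⟨fun u => ⟨φ.1 u, hmem φ u⟩, fun u u' h => φ.1.injective (congrArg Subtype.val h)⟩ :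
      U ↪ {x // x ∉ B})) ?_
  intro φ ψ h
  ext u
  exact congrArg (fun f : U ↪ {x // x ∉ B} => (f u : V)) h

open Classical in
/-- A random injection avoids a set `B` with probability at most `(1 - k / n) ^ |B|`. -/
theorem card_embedding_avoiding_mul_le (B : Finset V) :
    (univ.filter fun φ : U ↪ V => Disjoint B (univ.map φ)).card * Fintype.card V ^ B.card ≤
      (Fintype.card V - Fintype.card U) ^ B.card * Fintype.card (U ↪ V) := by
  set n := Fintype.card V
  set k := Fintype.card U
  set b := B.card
  have hb : b ≤ n := card_le_univ B
  have hpos : 0 < n.descFactorial b := Nat.descFactorial_pos.2 hb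
  have h1 : (n - b).descFactorial k * n.descFactorial b = n.descFactorial (b + k) := by
    have := Nat.descFactorial_mul_descFactorial (n := n) (k := b) (m := b + k) (by omega)
    rwa [Nat.add_sub_cancel_left] at this
  have h2 : (n - k).descFactorial b * n.descFactorial k = n.descFactorial (b + k) := by
    have := Nat.descFactorial_mul_descFactorial (n := n) (k := k) (m := b + k) (by omega)
    rwa [Nat.add_sub_cancel] at this
  rw [Fintype.card_embedding_eq]
  refine Nat.le_of_mul_le_mul_right ?_ hpos
  calc _ ≤ (n - b).descFactorial k * n ^ b * n.descFactorial b := by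
        gcongr
        exact card_embedding_avoiding_le B
    _ = ((n - k).descFactorial b * n ^ b) * n.descFactorial k := by
        rw [mul_right_comm, h1, ← h2]; ring
    _ ≤ ((n - k) ^ b * n.descFactorial b) * n.descFactorial k :=
        Nat.mul_le_mul_right _ (descFactorial_sub_mul_pow_le n k b)
    _ = _ := by ring

open Classical in
/-- A bound on an exponential moment: expand the power of two over the subsets of `A` that the image
of the injection avoids. -/
theorem sum_half_pow_card_inter_le (hkn : Fintype.card U ≤ Fintype.card V)
    (hn : 0 < Fintype.card V) (A : Finset V) :
    ∑ φ : U ↪ V, (1 / 2 : ℝ) ^ (A ∩ univ.map φ).card ≤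
      (1 - (Fintype.card U : ℝ) / (2 * Fintype.card V)) ^ A.card * Fintype.card (U ↪ V) := by
  set n := Fintype.card V
  set k := Fintype.card U
  have hnR : (0 : ℝ) < n := by exact_mod_cast hn
  have h1 : ∀ φ : U ↪ V, (1 / 2 : ℝ) ^ (A ∩ univ.map φ).card =
      (1 / 2) ^ A.card * ∑ B ∈ A.powerset, if Disjoint B (univ.map φ) then 1 else 0 := by
    intro φ
    have h2 : (A.powerset.filter fun B => Disjoint B (univ.map φ)) = (A \ univ.map φ).powerset := by
      ext B
      rw [mem_filter, mem_powerset, mem_powerset, subset_sdiff]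
    have h3 := card_sdiff_add_card_inter A (univ.map φ)
    rw [← Finset.sum_filter, h2, sum_const, card_powerset, nsmul_eq_mul, mul_one, ← h3, pow_add]
    push_cast
    rw [mul_right_comm, ← mul_pow]
    norm_num
  have h4 : ∀ B : Finset V, (∑ φ : U ↪ V, if Disjoint B (univ.map φ) then (1 : ℝ) else 0) ≤
      (1 - (k : ℝ) / n) ^ B.card * Fintype.card (U ↪ V) := by
    intro B
    rw [← Finset.sum_filter, sum_const, nsmul_eq_mul, mul_one]
    have h5 := card_embedding_avoiding_mul_le (U := U) B
    have h6 : ((univ.filter fun φ : U ↪ V => Disjoint B (univ.map φ)).card : ℝ) * n ^ B.card ≤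
        (n - k : ℝ) ^ B.card * Fintype.card (U ↪ V) := by
      rw [← Nat.cast_sub hkn]
      exact_mod_cast h5
    have h7 : (1 - (k : ℝ) / n) = (n - k) / n := by field_simp
    rw [h7, div_pow, div_mul_eq_mul_div, le_div_iff₀ (by positivity)]
    exact h6
  calc ∑ φ : U ↪ V, (1 / 2 : ℝ) ^ (A ∩ univ.map φ).card
      = (1 / 2) ^ A.card * ∑ B ∈ A.powerset,
          ∑ φ : U ↪ V, if Disjoint B (univ.map φ) then (1 : ℝ) else 0 := by
        rw [Finset.sum_comm, mul_sum]
        exact sum_congr rfl fun φ _ => h1 φ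
    _ ≤ (1 / 2) ^ A.card * ∑ B ∈ A.powerset,
          (1 - (k : ℝ) / n) ^ B.card * Fintype.card (U ↪ V) := by
        gcongr with B
        exact h4 B
    _ = (1 / 2) ^ A.card * ((1 - (k : ℝ) / n + 1) ^ A.card * Fintype.card (U ↪ V)) := by
        rw [← sum_mul]
        congr 2
        rw [← Finset.sum_pow_mul_eq_add_pow]
        exact sum_congr rfl fun B _ => by rw [one_pow, mul_one]
    _ = _ := by
        rw [← mul_assoc, ← mul_pow]
        congr 2
        field_simp
        ring

open Classical in
/-- With probability at least `1 - exp (-3μ/20)`, the image of a random injection contains more than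
half of the expected number `μ = k |A| / n` of elements of `A`. -/
theorem card_embedding_lowerTail_le (hkn : Fintype.card U ≤ Fintype.card V)
    (hn : 0 < Fintype.card V) (A : Finset V) :
    ((univ.filter fun φ : U ↪ V => ((A ∩ univ.map φ).card : ℝ) ≤
      Fintype.card U * A.card / Fintype.card V / 2).card : ℝ) ≤
      Real.exp (-(3 / 20) * (Fintype.card U * A.card / Fintype.card V)) *
        Fintype.card (U ↪ V) := by
  have hsum := sum_half_pow_card_inter_le hkn hn A
  set n := Fintype.card V
  set k := Fintype.card U
  have hnR : (0 : ℝ) < n := by exact_mod_cast hn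
  have hknR : (k : ℝ) ≤ n := by exact_mod_cast hkn
  set N : ℝ := (Fintype.card (U ↪ V) : ℝ)
  have hN : 0 ≤ N := Nat.cast_nonneg _
  set μ : ℝ := k * A.card / n with hμ
  have hμ0 : 0 ≤ μ := by positivity
  set F := univ.filter fun φ : U ↪ V => ((A ∩ univ.map φ).card : ℝ) ≤ μ / 2 with hF
  have h1 : (F.card : ℝ) * Real.exp (-Real.log 2 * (μ / 2)) ≤
      ∑ φ : U ↪ V, (1 / 2 : ℝ) ^ (A ∩ univ.map φ).card := by
    calc (F.card : ℝ) * Real.exp (-Real.log 2 * (μ / 2))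
        = ∑ φ ∈ F, Real.exp (-Real.log 2 * (μ / 2)) := by rw [sum_const, nsmul_eq_mul]
      _ ≤ ∑ φ ∈ F, (1 / 2 : ℝ) ^ (A ∩ univ.map φ).card := by
          refine sum_le_sum fun φ hφ => ?_
          have h2 : (1 / 2 : ℝ) ^ (A ∩ univ.map φ).card =
              Real.exp (-Real.log 2 * (A ∩ univ.map φ).card) := by
            rw [mul_comm, Real.exp_nat_mul, Real.exp_neg, Real.exp_log (by norm_num), one_div]
          rw [h2, Real.exp_le_exp]
          have h3 := (mem_filter.1 hφ).2
          have h4 := Real.log_pos (show (1 : ℝ) < 2 by norm_num)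
          nlinarith
      _ ≤ _ := sum_le_sum_of_subset_of_nonneg (subset_univ _) fun _ _ _ => by positivity
  have h2 : (1 - (k : ℝ) / (2 * n)) ^ A.card ≤ Real.exp (-(μ / 2)) := by
    have h3 : 1 - (k : ℝ) / (2 * n) ≤ Real.exp (-(k / (2 * n))) := by
      have := Real.add_one_le_exp (-((k : ℝ) / (2 * n)))
      linarith
    have h4 : 0 ≤ 1 - (k : ℝ) / (2 * n) := by
      rw [sub_nonneg, div_le_one (by positivity)]
      linarith
    calc _ ≤ Real.exp (-(k / (2 * n))) ^ A.card := pow_le_pow_left₀ h4 h3 _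
      _ = Real.exp (-(μ / 2)) := by
          rw [← Real.exp_nat_mul]
          congr 1
          rw [hμ]
          field_simp
  have h3 : (F.card : ℝ) * Real.exp (-Real.log 2 * (μ / 2)) ≤ Real.exp (-(μ / 2)) * N :=
    h1.trans (hsum.trans (mul_le_mul_of_nonneg_right h2 hN))
  have h4 : (F.card : ℝ) ≤ Real.exp (-(μ / 2)) * N * Real.exp (Real.log 2 * (μ / 2)) := by
    calc (F.card : ℝ) = F.card * Real.exp (-Real.log 2 * (μ / 2)) *
          Real.exp (Real.log 2 * (μ / 2)) := by
          rw [mul_assoc, ← Real.exp_add]; simp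
      _ ≤ _ := by gcongr
  refine h4.trans ?_
  rw [mul_right_comm, ← Real.exp_add]
  refine mul_le_mul_of_nonneg_right (Real.exp_le_exp.2 ?_) hN
  have := Real.log_two_lt_d9
  nlinarith

open Classical in
/-- A bound on the probability of an event of `𝒢(G, H)` from a count of exceptional injections. -/
theorem ofReal_le_randomPlanting (G : SimpleGraph V) (H : SimpleGraph U)
    (h : Fintype.card U ≤ Fintype.card V) {E : Set (SimpleGraph V)} {ε : ℝ}
    (B : Finset (U ↪ V)) (hB : (B.card : ℝ) ≤ ε * Fintype.card (U ↪ V))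
    (hE : ∀ φ ∉ B, G ⊔ H.map φ ∈ E) :
    ENNReal.ofReal (1 - ε) ≤ (randomPlanting G H h).toOuterMeasure E := by
  have : Nonempty (U ↪ V) := Function.Embedding.nonempty_of_card_le h
  have hN : (0 : ℝ) < Fintype.card (U ↪ V) := by exact_mod_cast Fintype.card_pos
  have hmap : randomPlanting G H h =
      (PMF.uniformOfFintype (U ↪ V)).map fun φ : U ↪ V => G ⊔ H.map φ := by
    have hdec : ‹DecidableEq V› = fun a b => Classical.propDecidable (a = b) :=
      Subsingleton.elim _ _
    subst hdec
    change ((PMF.uniformOfFintype (U ↪ V)).map fun φ : U ↪ V => (φ : U → V)).map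
      (fun φ => G ⊔ H.map φ) = _
    rw [PMF.map_comp]
    rfl
  rw [hmap, PMF.toOuterMeasure_map_apply, PMF.toOuterMeasure_uniformOfFintype_apply]
  have hle : (Bᶜ).card ≤
      Fintype.card ((fun φ : U ↪ V => G ⊔ H.map φ) ⁻¹' E : Set (U ↪ V)) := by
    rw [← Set.toFinset_card]
    refine card_le_card fun φ hφ => ?_
    rw [Set.mem_toFinset]
    exact hE φ (mem_compl.1 hφ)
  have h1 : (1 - ε) ≤ ((Bᶜ).card : ℝ) / Fintype.card (U ↪ V) := by
    rw [le_div_iff₀ hN, card_compl, Nat.cast_sub (card_le_univ B)]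
    linarith
  refine (ENNReal.ofReal_le_ofReal h1).trans ?_
  rw [ENNReal.ofReal_div_of_pos hN, ENNReal.ofReal_natCast, ENNReal.ofReal_natCast]
  gcongr

end Tail

/-! ### Graphs with a planted clique -/

section Planted

open Finset Classical

variable {n : ℕ}

/-- The vertices that are not adjacent to `v`, which include `v` itself. -/
noncomputable def nonNeighbors (G : SimpleGraph (Fin n)) (v : Fin n) : Finset (Fin n) :=
  univ.filter fun w => ¬ G.Adj v w

theorem mem_nonNeighbors {G : SimpleGraph (Fin n)} {v w : Fin n} :
    w ∈ nonNeighbors G v ↔ ¬ G.Adj v w := by simp [nonNeighbors]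

theorem degree_add_card_nonNeighbors (G : SimpleGraph (Fin n)) (v : Fin n) :
    G.degree v + (nonNeighbors G v).card = n := by
  have h : nonNeighbors G v = (G.neighborFinset v)ᶜ := by
    ext w; simp [nonNeighbors]
  rw [h, ← SimpleGraph.card_neighborFinset_eq_degree, card_add_card_compl, Fintype.card_fin]

/-- The vertices with at most `τ` non-neighbours. -/
noncomputable def denseVertices (G : SimpleGraph (Fin n)) (τ : ℝ) : Finset (Fin n) :=
  univ.filter fun v => ((nonNeighbors G v).card : ℝ) ≤ τ

/-- The graph `G` with a clique planted on the image of `φ`. -/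
def plantClique {k : ℕ} (G : SimpleGraph (Fin n)) (φ : Fin k ↪ Fin n) : SimpleGraph (Fin n) :=
  G ⊔ (⊤ : SimpleGraph (Fin k)).map φ

variable {k : ℕ} (G : SimpleGraph (Fin n)) (φ : Fin k ↪ Fin n)

theorem plantClique_adj {v w : Fin n} : (plantClique G φ).Adj v w ↔
    G.Adj v w ∨ (v ≠ w ∧ v ∈ univ.map φ ∧ w ∈ univ.map φ) := by
  simp only [plantClique, SimpleGraph.sup_adj, SimpleGraph.map_adj, SimpleGraph.top_adj, Finset.mem_map,
    mem_univ, true_and]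
  refine or_congr Iff.rfl ⟨?_, ?_⟩
  · rintro ⟨x, y, hxy, rfl, rfl⟩
    exact ⟨fun h => hxy (φ.injective h), ⟨x, rfl⟩, ⟨y, rfl⟩⟩
  · rintro ⟨hne, ⟨x, rfl⟩, ⟨y, rfl⟩⟩
    exact ⟨x, y, fun h => hne (by rw [h]), rfl, rfl⟩

theorem plantClique_isClique :
    (plantClique G φ).IsClique ((univ.map φ : Finset (Fin n)) : Set (Fin n)) :=
  fun _ hv _ hw hvw => (plantClique_adj G φ).2 (.inr ⟨hvw, hv, hw⟩)

theorem nonNeighbors_plantClique_of_notMem {v : Fin n} (hv : v ∉ univ.map φ) :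
    nonNeighbors (plantClique G φ) v = nonNeighbors G v := by
  ext w
  rw [mem_nonNeighbors, mem_nonNeighbors, plantClique_adj]
  tauto

theorem card_nonNeighbors_plantClique_le {v : Fin n} (hv : v ∈ univ.map φ) :
    (nonNeighbors (plantClique G φ) v).card + (nonNeighbors G v ∩ univ.map φ).card ≤
      (nonNeighbors G v).card + 1 := by
  have h1 : nonNeighbors (plantClique G φ) v ⊆ insert v (nonNeighbors G v \ univ.map φ) := by
    intro w hw
    rw [mem_nonNeighbors, plantClique_adj] at hw
    rw [mem_insert, Finset.mem_sdiff, mem_nonNeighbors]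
    by_cases hwv : w = v
    · exact .inl hwv
    · exact .inr ⟨fun h => hw (.inl h), fun h => hw (.inr ⟨Ne.symm hwv, hv, h⟩)⟩
  have h2 := (card_le_card h1).trans (card_insert_le _ _)
  have h3 := card_sdiff_add_card_inter (nonNeighbors G v) (univ.map φ)
  omega

/-- Planting the clique moves its vertices up in the order of degrees: if more than half of the
expected number of non-neighbours of every vertex get into the clique, then the vertices of the
planted graph with at most `τ` non-neighbours comprise the members of the clique that had at most
`τ'` of them, and those outside the clique had at most `τ` of them already. The number `s` is the
size of a clique that the search returns. -/
theorem card_denseVertices_inter_le {s : ℕ} {τ τ' : ℝ} (hn : 0 < n) (hkn : k ≤ n)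
    (hs : ∀ d (T : Finset (Fin n)), (plantClique G φ).IsClique (T : Set (Fin n)) →
      ((univ.filter fun v => d ≤ (plantClique G φ).degree v) ∩ T).card ≤
        s + ((univ.filter fun v => d ≤ (plantClique G φ).degree v) \ T).card)
    (hconc : ∀ v, (k : ℝ) * (nonNeighbors G v).card / n / 2 <
      ((nonNeighbors G v ∩ univ.map φ).card : ℝ))
    (hτ : τ' * (1 - k / (2 * n)) ≤ τ - 1) :
    (denseVertices G τ' ∩ univ.map φ).card ≤ s + (denseVertices G τ).card := by
  have hnR : (0 : ℝ) < n := by exact_mod_cast hn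
  have hknR : (k : ℝ) ≤ n := by exact_mod_cast hkn
  set d := ⌈(n : ℝ) - τ⌉₊ with hd
  have hdeg : ∀ v, d ≤ (plantClique G φ).degree v ↔
      ((nonNeighbors (plantClique G φ) v).card : ℝ) ≤ τ := by
    intro v
    have h1 : ((plantClique G φ).degree v : ℝ) + (nonNeighbors (plantClique G φ) v).card = n := by
      exact_mod_cast degree_add_card_nonNeighbors (plantClique G φ) v
    rw [hd, Nat.ceil_le]
    constructor <;> intro h <;> linarith
  refine le_trans ?_ ((hs d _ (plantClique_isClique G φ)).trans ?_)
  · refine card_le_card fun v hv => ?_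
    rw [mem_inter] at hv ⊢
    refine ⟨mem_filter.2 ⟨mem_univ _, (hdeg v).2 ?_⟩, hv.2⟩
    have h1 : ((nonNeighbors G v).card : ℝ) ≤ τ' := (mem_filter.1 hv.1).2
    have h2 : ((nonNeighbors (plantClique G φ) v).card : ℝ) +
        (nonNeighbors G v ∩ univ.map φ).card ≤ (nonNeighbors G v).card + 1 := by
      exact_mod_cast card_nonNeighbors_plantClique_le G φ hv.2
    have h3 : (0 : ℝ) ≤ 1 - k / (2 * n) := by
      rw [sub_nonneg, div_le_one (by positivity)]
      linarith
    have h4 := mul_le_mul_of_nonneg_right h1 h3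
    have h5 : ((nonNeighbors G v).card : ℝ) * (1 - k / (2 * n)) =
        (nonNeighbors G v).card - k * (nonNeighbors G v).card / n / 2 := by
      field_simp
    have h6 := hconc v
    linarith
  · refine Nat.add_le_add_left (card_le_card fun v hv => ?_) _
    rw [Finset.mem_sdiff, mem_filter] at hv
    have h1 := (hdeg v).1 hv.1.2
    rw [nonNeighbors_plantClique_of_notMem G φ hv.2] at h1
    exact mem_filter.2 ⟨mem_univ _, h1⟩

/-- The length of the input is at least `k ^ 2`, because of the planted clique. -/
theorem sq_le_plantClique_edges (hkn : k ≤ n) :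
    k * k ≤ 1 + n + 2 * (plantClique G φ).edgeSet.ncard := by
  have h1 : 2 * (plantClique G φ).edgeSet.ncard = ∑ v, (plantClique G φ).degree v := by
    rw [SimpleGraph.sum_degrees_eq_twice_card_edges, ← SimpleGraph.coe_edgeFinset,
      Set.ncard_coe_finset]
  have h2 : ∀ v ∈ univ.map φ, k - 1 ≤ (plantClique G φ).degree v := by
    intro v hv
    have h3 : (univ.map φ).erase v ⊆ (plantClique G φ).neighborFinset v := by
      intro w hw
      rw [mem_erase] at hw
      rw [SimpleGraph.mem_neighborFinset, plantClique_adj]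
      exact .inr ⟨hw.1.symm, hv, hw.2⟩
    have h4 := card_le_card h3
    rwa [card_erase_of_mem hv, card_map, card_univ, Fintype.card_fin,
      SimpleGraph.card_neighborFinset_eq_degree] at h4
  have h5 : k * (k - 1) ≤ ∑ v, (plantClique G φ).degree v := by
    calc k * (k - 1) = ∑ v ∈ univ.map φ, (k - 1) := by simp
      _ ≤ ∑ v ∈ univ.map φ, (plantClique G φ).degree v := sum_le_sum h2
      _ ≤ _ := sum_le_sum_of_subset (subset_univ _)
  have h6 : k * k ≤ k * (k - 1) + k := by
    cases k with
    | zero => simp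
    | succ m => rw [Nat.add_sub_cancel]; ring_nf; omega
  omega

theorem logb_le_inputLog (hn : 0 < n) : Real.logb 2 n ≤ inputLog G := by
  rw [Real.logb_le_iff_le_rpow (by norm_num) (by exact_mod_cast hn), Real.rpow_natCast]
  have h1 : 1 + n + 2 * G.edgeSet.ncard ≤ 2 ^ inputLog G := by
    unfold inputLog
    exact (Nat.le_pow_clog (by norm_num) _).trans (Nat.pow_le_pow_right (by norm_num) (by omega))
  have h2 : n ≤ 2 ^ inputLog G := by omega
  exact_mod_cast h2

end Planted

/-! ### Numerical estimates -/

/-- A sequence that starts at `0` and reaches `M` at time `I` has a step by a factor of at least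
`1 / x` that ends at `x ^ I * M` or above. -/
theorem exists_large_step {m : ℕ → ℝ} {x M : ℝ} {I : ℕ} (hx : 0 < x) (hx1 : x ≤ 1) (hM : 0 < M)
    (h0 : m 0 = 0) (hI : M ≤ m I) :
    ∃ i, m i ≤ x * m (i + 1) ∧ x ^ I * M ≤ m (i + 1) := by
  classical
  have hex : ∃ j, x ^ (I - j) * M ≤ m j := ⟨I, by simpa using hI⟩
  have hspec := Nat.find_spec hex
  set j := Nat.find hex with hj
  have hj0 : j ≠ 0 := by
    intro h
    rw [h, h0] at hspec
    have : 0 < x ^ (I - 0) * M := by positivity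
    linarith
  have hjI : j ≤ I := Nat.find_min' hex (by simpa using hI)
  obtain ⟨i, hi⟩ := Nat.exists_eq_succ_of_ne_zero hj0
  have hmin := Nat.find_min hex (m := i) (by omega)
  rw [hi, Nat.succ_eq_add_one] at hspec
  refine ⟨i, ?_, le_trans ?_ hspec⟩
  · have h1 : I - i = I - (i + 1) + 1 := by omega
    rw [h1, pow_succ] at hmin
    push Not at hmin
    nlinarith
  · exact mul_le_mul_of_nonneg_right (pow_le_pow_of_le_one hx.le hx1 (by omega)) hM.le

/-- The number of non-neighbours is polynomially large if the clique bound is not trivial. -/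
theorem eight_div_le_pow_three {n : ℕ} {c p : ℝ} (hn : 0 < n) (hc : 0 < c) (hc1 : c ≤ 1)
    (hp : 0 < p) (hp1 : p ≤ 1) (hK : 1 ≤ cliqueBound n c p) : 8 ≤ n * p ^ 3 := by
  have hnR : (0 : ℝ) < n := by exact_mod_cast hn
  unfold cliqueBound at hK
  set y := Real.logb 2 (2 / p) with hy
  have hy0 : 0 ≤ y := Real.logb_nonneg (by norm_num) (by rw [le_div_iff₀ hp]; linarith)
  have h2p : (2 : ℝ) ^ y = 2 / p := Real.rpow_logb (by norm_num) (by norm_num) (by positivity)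
  have h1 : (c / 3) ^ (2 + 2 / c * y) ≤ (1 / 3 : ℝ) ^ (2 * y) := by
    have h2 : 2 * y ≤ 2 + 2 / c * y := by
      have : 2 ≤ 2 / c := by rw [le_div_iff₀ hc]; linarith
      nlinarith
    calc (c / 3) ^ (2 + 2 / c * y) ≤ (1 / 3 : ℝ) ^ (2 + 2 / c * y) :=
          Real.rpow_le_rpow (by positivity) (by linarith) (by linarith)
      _ ≤ _ := Real.rpow_le_rpow_of_exponent_ge (by norm_num) (by norm_num) h2
  have h3 : (1 / 3 : ℝ) ^ (2 * y) ≤ (p / 2) ^ 3 := by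
    calc (1 / 3 : ℝ) ^ (2 * y) = (1 / 9 : ℝ) ^ y := by
          rw [Real.rpow_mul (by norm_num)]; norm_num
      _ ≤ (1 / 8 : ℝ) ^ y := Real.rpow_le_rpow (by norm_num) (by norm_num) hy0
      _ = ((2 : ℝ) ^ y)⁻¹ ^ 3 := by
          rw [← Real.inv_rpow (by norm_num), ← Real.rpow_natCast, ← Real.rpow_mul (by norm_num),
            mul_comm y, Real.rpow_mul (by norm_num)]
          norm_num
      _ = _ := by rw [h2p, inv_div]
  have h4 : 1 ≤ (n : ℝ) / 5 * (p / 2) ^ 3 :=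
    hK.trans (mul_le_mul_of_nonneg_left (h1.trans h3) (by positivity))
  have h5 : (n : ℝ) / 5 * (p / 2) ^ 3 = n * p ^ 3 / 40 := by ring
  rw [h5] at h4
  linarith

/-- In `(2 / c) log (1 / p)` rounds of growth by the factor `1 + c / 2`, `p` reaches `1`. -/
theorem one_le_mul_pow_of_logb_le {c p : ℝ} (hc : 0 < c) (hc1 : c ≤ 1) (hp : 0 < p) (hp1 : p ≤ 1)
    {N : ℕ} (hN : 2 / c * Real.logb 2 (1 / p) ≤ N) : 1 ≤ p * (1 + c / 2) ^ N := by
  have h1 : (2 : ℝ) ≤ (1 + c / 2) ^ (2 / c) := by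
    have h2 : 1 ≤ 2 / c := by rw [le_div_iff₀ hc]; linarith
    have h3 := one_add_mul_self_le_rpow_one_add (s := c / 2) (by linarith) h2
    have h4 : 1 + 2 / c * (c / 2) = 2 := by field_simp; norm_num
    linarith
  have hy : 0 ≤ Real.logb 2 (1 / p) :=
    Real.logb_nonneg (by norm_num) (by rw [le_div_iff₀ hp]; linarith)
  have h5 : 1 / p ≤ (1 + c / 2) ^ N := by
    calc 1 / p = (2 : ℝ) ^ Real.logb 2 (1 / p) :=
          (Real.rpow_logb (by norm_num) (by norm_num) (by positivity)).symm
      _ ≤ ((1 + c / 2) ^ (2 / c)) ^ Real.logb 2 (1 / p) := Real.rpow_le_rpow (by norm_num) h1 hy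
      _ = (1 + c / 2) ^ (2 / c * Real.logb 2 (1 / p)) := (Real.rpow_mul (by linarith) _ _).symm
      _ ≤ (1 + c / 2) ^ (N : ℝ) := Real.rpow_le_rpow_of_exponent_le (by linarith) hN
      _ = _ := Real.rpow_natCast _ _
  rw [div_le_iff₀ hp] at h5
  linarith

/-- The requirements on `n`, for a given exponent `a`. -/
theorem eventually_log_sq_le (a : ℝ) : ∀ᶠ n : ℕ in atTop,
    1 ≤ Real.log n ∧ 100 * (a + 2) * Real.log n ^ 2 ≤ (n : ℝ) ^ (2 / 3 : ℝ) := by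
  have h1 : ∀ᶠ x : ℝ in atTop, 1 ≤ Real.log x := Real.tendsto_log_atTop.eventually_ge_atTop 1
  have h2 := (isLittleO_log_rpow_rpow_atTop (2 : ℝ) (show (0 : ℝ) < 2 / 3 by norm_num)).def
    (show (0 : ℝ) < (1 / (100 * (|a| + 2))) by positivity)
  have h3 : ∀ᶠ x : ℝ in atTop,
      1 ≤ Real.log x ∧ 100 * (a + 2) * Real.log x ^ 2 ≤ x ^ (2 / 3 : ℝ) := by
    filter_upwards [h1, h2, eventually_ge_atTop 0] with x hx1 hx2 hx0
    refine ⟨hx1, ?_⟩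
    rw [Real.norm_of_nonneg (by positivity), Real.norm_of_nonneg (by positivity), div_mul_eq_mul_div,
      le_div_iff₀ (by positivity), one_mul, Real.rpow_two] at hx2
    refine le_trans ?_ hx2
    rw [mul_comm]
    gcongr
    exact le_abs_self a
  exact tendsto_natCast_atTop_atTop.eventually h3

/-! ### The guarantee for a fixed graph -/

section Guarantee

open Finset Classical

/-- The inequalities between `n`, `c`, `p`, `k` and `a` that hold for large `n`. The number `r` is
a lower bound for the numbers of non-neighbours, namely `n ^ (2 / 3)`. -/
structure LargeEnough (n k : ℕ) (a c p r : ℝ) : Prop where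
  n_pos : (0 : ℝ) < n
  c_pos : 0 < c
  c_le : c ≤ 1
  p_pos : 0 < p
  p_le : p ≤ 1
  r_pos : 0 < r
  r_le : r ≤ p * n
  sq : 16 ≤ c ^ 2 * r
  inv : 1 / n ≤ c ^ 2 / 8
  inv' : 1 / n ≤ c / 600
  k_half : c / 2 ≤ k / n
  k_near : c - 1 / n ≤ k / n
  k_p : 30 * (a + 2) * Real.log n ≤ 3 / 20 * (k * p)
  k_log : (n : ℝ) ≤ k * Real.logb 2 n

theorem largeEnough {n k : ℕ} {a c p : ℝ} (ha : 1 ≤ a) (hc : 0 < c) (hc1 : c ≤ 1)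
    (hlog : 1 ≤ Real.log n) (hlarge : 100 * (a + 2) * Real.log n ^ 2 ≤ (n : ℝ) ^ (2 / 3 : ℝ))
    (hclog : 1 / Real.logb 2 n ≤ 1 / 4 * c) (hp : 0 < p) (hp1 : p ≤ 1)
    (hK : 1 ≤ cliqueBound n c p) (hk : |(k : ℝ) - c * n| < 1) :
    LargeEnough n k a c p ((n : ℝ) ^ (2 / 3 : ℝ)) := by
  have hn0 : 0 < n := by
    rcases Nat.eq_zero_or_pos n with h | h
    · rw [h] at hlog; norm_num at hlog
    · exact h
  have hn : (0 : ℝ) < n := by exact_mod_cast hn0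
  have hn1 : (1 : ℝ) ≤ n := by exact_mod_cast hn0
  set r := (n : ℝ) ^ (2 / 3 : ℝ) with hr
  set ℓ := Real.log n with hℓ
  have hr0 : 0 < r := by positivity
  have hrn : r ≤ n := by
    calc r ≤ (n : ℝ) ^ (1 : ℝ) := Real.rpow_le_rpow_of_exponent_le hn1 (by norm_num)
      _ = n := Real.rpow_one _
  have hr3 : r ^ 3 = (n : ℝ) ^ 2 := by
    rw [hr, ← Real.rpow_natCast, ← Real.rpow_mul hn.le, ← Real.rpow_natCast]
    norm_num
  have hlog2 := Real.log_two_gt_d9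
  have hlogb : Real.logb 2 n = ℓ / Real.log 2 := rfl
  have hlogb0 : 0 < Real.logb 2 n := by rw [hlogb]; positivity
  have hcb : 4 ≤ c * Real.logb 2 n := by
    rw [div_le_iff₀ hlogb0] at hclog; linarith
  have hcl : 2 ≤ c * ℓ := by
    have h1 : ℓ = Real.logb 2 n * Real.log 2 := by rw [hlogb]; field_simp
    rw [h1, ← mul_assoc]
    nlinarith
  have hr300 : 300 * ℓ ^ 2 ≤ r := le_trans (by nlinarith [sq_nonneg ℓ]) hlarge
  have hc2r : 1200 ≤ c ^ 2 * r := by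
    calc (1200 : ℝ) ≤ 300 * (c * ℓ) ^ 2 := by nlinarith
      _ = c ^ 2 * (300 * ℓ ^ 2) := by ring
      _ ≤ c ^ 2 * r := by gcongr
  have hcn : 600 ≤ c * n := by
    have h1 : c ^ 2 * r ≤ c * n := by
      calc c ^ 2 * r ≤ c * r := by gcongr; nlinarith
        _ ≤ c * n := by gcongr
    linarith
  have hcr : 200 * (a + 2) * ℓ ≤ c * r := by
    calc 200 * (a + 2) * ℓ = 100 * (a + 2) * ℓ * 2 := by ring
      _ ≤ 100 * (a + 2) * ℓ * (c * ℓ) := by gcongr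
      _ = c * (100 * (a + 2) * ℓ ^ 2) := by ring
      _ ≤ c * r := by gcongr
  have hp3 := eight_div_le_pow_three hn0 hc hc1 hp hp1 hK
  have h2r : 2 * r ≤ p * n := by
    refine le_of_pow_le_pow_left₀ (n := 3) (by norm_num) (by positivity) ?_
    calc (2 * r) ^ 3 = 8 * (n : ℝ) ^ 2 := by rw [mul_pow, hr3]; norm_num
      _ ≤ (n * p ^ 3) * (n : ℝ) ^ 2 := by gcongr
      _ = (p * n) ^ 3 := by ring
  have hk1 : c * n - 1 ≤ k := by linarith [(abs_lt.1 hk).1]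
  have hk2 : c * n / 2 ≤ k := by linarith
  have hkn : c / 2 ≤ k / n := by rw [le_div_iff₀ hn]; linarith
  refine ⟨hn, hc, hc1, hp, hp1, hr0, by linarith, by linarith, ?_, ?_, hkn, ?_, ?_, ?_⟩
  · rw [div_le_iff₀ hn]
    have : c ^ 2 * r ≤ c ^ 2 * n := by gcongr
    linarith
  · rw [div_le_iff₀ hn]; linarith
  · rw [le_div_iff₀ hn, sub_mul, one_div_mul_cancel hn.ne']; exact hk1
  · have h1 : c * r ≤ k * p := by
      calc c * r = c / 2 * (2 * r) := by ring
        _ ≤ c / 2 * (p * n) := by gcongr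
        _ = c * n / 2 * p := by ring
        _ ≤ k * p := by gcongr
    linarith
  · calc (n : ℝ) ≤ n * (c * Real.logb 2 n / 2) := by nlinarith
      _ = c * n / 2 * Real.logb 2 n := by ring
      _ ≤ k * Real.logb 2 n := by gcongr

/-- There are two thresholds `τ < τ'` that differ by a factor `1 + c / 2`, such that many vertices
of `G` have at most `τ'` non-neighbours, and only a few of them have at most `τ`. -/
theorem exists_threshold {n k : ℕ} {a c p r : ℝ} (h : LargeEnough n k a c p r)
    (G : SimpleGraph (Fin n)) (hG : ∀ v, p * n ≤ (nonNeighbors G v).card) :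
    ∃ τ τ' : ℝ, τ' * (1 - k / (2 * n)) ≤ τ - 1 ∧
      ((denseVertices G τ).card : ℝ) ≤ c / 3 * (denseVertices G τ').card ∧
      cliqueBound n c p ≤ c ^ 2 / 45 * (denseVertices G τ').card := by
  obtain ⟨hn, hc, hc1, hp, hp1, hr, hrp, hsq, hinv, -, -, hkn, -, -⟩ := h
  -- the factor `1 / (1 + c / 2)` puts the first threshold below every number of non-neighbours
  set N := ⌈2 / c * Real.logb 2 (1 / p)⌉₊ with hN
  set τ₀ := p * n / (1 + c / 2) with hτ₀
  set τ : ℕ → ℝ := fun i => τ₀ * (1 + c / 2) ^ i with hτ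
  have hτ₀pos : 0 < τ₀ := by positivity
  have hτ₀r : r / 2 ≤ τ₀ := by
    rw [hτ₀, le_div_iff₀ (by positivity)]
    nlinarith
  have h0 : ((denseVertices G (τ 0)).card : ℝ) = 0 := by
    rw [Nat.cast_eq_zero, card_eq_zero]
    refine filter_eq_empty_iff.2 fun v _ => ?_
    have h1 : τ 0 < p * n := by
      simp only [hτ, pow_zero, mul_one, hτ₀]
      rw [div_lt_iff₀ (by positivity)]
      have : 0 < p * n := by positivity
      nlinarith
    exact not_le.2 (h1.trans_le (hG v))
  have hI : (n : ℝ) ≤ (denseVertices G (τ (N + 1))).card := by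
    have h1 : denseVertices G (τ (N + 1)) = univ := by
      refine filter_true_of_mem fun v _ => ?_
      have h2 : ((nonNeighbors G v).card : ℝ) ≤ n := by
        exact_mod_cast (card_le_univ _).trans (by simp)
      have h3 : τ (N + 1) = p * (1 + c / 2) ^ N * n := by
        simp only [hτ, hτ₀, pow_succ]
        field_simp
      have h4 := one_le_mul_pow_of_logb_le hc hc1 hp hp1 (Nat.le_ceil _ : _ ≤ (N : ℝ))
      rw [h3]
      nlinarith
    rw [h1, card_univ, Fintype.card_fin]
  obtain ⟨i, hi1, hi2⟩ := exists_large_step (m := fun i => ((denseVertices G (τ i)).card : ℝ))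
    (x := c / 3) (by positivity) (by linarith) hn h0 hI
  refine ⟨τ i, τ (i + 1), ?_, hi1, ?_⟩
  · have h1 : τ (i + 1) = τ i * (1 + c / 2) := by simp only [hτ, pow_succ]; ring
    have h2 : τ₀ ≤ τ i := le_mul_of_one_le_right hτ₀pos.le (one_le_pow₀ (by linarith))
    have h3 : (1 + c / 2) * (1 - k / (2 * n)) ≤ 1 - c ^ 2 / 8 := by
      have h4 : 1 - (k : ℝ) / (2 * n) ≤ 1 - c / 2 + 1 / n / 2 := by
        have : (k : ℝ) / (2 * n) = k / n / 2 := by field_simp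
        rw [this]; linarith
      calc (1 + c / 2) * (1 - k / (2 * n)) ≤ (1 + c / 2) * (1 - c / 2 + 1 / n / 2) := by gcongr
        _ = 1 - c ^ 2 / 4 + (1 + c / 2) * (1 / n / 2) := by ring
        _ ≤ 1 - c ^ 2 / 4 + 2 * (1 / n / 2) := by gcongr; linarith
        _ ≤ _ := by linarith
    rw [h1, mul_assoc]
    have h5 : τ i * ((1 + c / 2) * (1 - k / (2 * n))) ≤ τ i * (1 - c ^ 2 / 8) := by
      have : 0 ≤ τ i := hτ₀pos.le.trans h2
      gcongr
    have h6 : c ^ 2 * (r / 2) ≤ c ^ 2 * τ i :=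
      mul_le_mul_of_nonneg_left (hτ₀r.trans h2) (by positivity)
    linarith
  · refine le_trans ?_ (mul_le_mul_of_nonneg_left hi2 (by positivity))
    unfold cliqueBound
    have hT : ((N + 1 : ℕ) : ℝ) ≤ 2 / c * Real.logb 2 (2 / p) := by
      have h1 : Real.logb 2 (2 / p) = 1 + Real.logb 2 (1 / p) := by
        rw [show 2 / p = 2 * (1 / p) by ring, Real.logb_mul (by norm_num) (by positivity),
          Real.logb_self_eq_one (by norm_num)]
      have h2 : 0 ≤ Real.logb 2 (1 / p) :=
        Real.logb_nonneg (by norm_num) (by rw [le_div_iff₀ hp]; linarith)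
      have h3 := Nat.ceil_lt_add_one (show 0 ≤ 2 / c * Real.logb 2 (1 / p) by positivity)
      have h4 : 2 ≤ 2 / c := by rw [le_div_iff₀ hc]; linarith
      rw [h1, mul_add, mul_one]
      push_cast
      linarith
    have h1 : (c / 3) ^ (2 + 2 / c * Real.logb 2 (2 / p)) ≤ (c / 3) ^ 2 * (c / 3) ^ (N + 1) := by
      rw [Real.rpow_add (by positivity), Real.rpow_two]
      gcongr
      rw [← Real.rpow_natCast (c / 3) (N + 1)]
      exact Real.rpow_le_rpow_of_exponent_ge (by positivity) (by linarith) hT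
    calc (n : ℝ) / 5 * (c / 3) ^ (2 + 2 / c * Real.logb 2 (2 / p))
        ≤ n / 5 * ((c / 3) ^ 2 * (c / 3) ^ (N + 1)) := by gcongr
      _ = c ^ 2 / 45 * ((c / 3) ^ (N + 1) * n) := by ring

/-- The probability bound for a graph in which every vertex has at least `p n` non-neighbours. -/
theorem randomPlanting_ge {n k : ℕ} {a c p r : ℝ} (h : LargeEnough n k a c p r) (ha : 1 ≤ a)
    (hlog : 1 ≤ Real.log n) (hK : 1 + 2 * a * Real.log n ≤ cliqueBound n c p)
    (G : SimpleGraph (Fin n)) (hG : ∀ v, p * n ≤ (nonNeighbors G v).card)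
    (hk : Fintype.card (Fin k) ≤ Fintype.card (Fin n)) :
    ENNReal.ofReal (1 - (n : ℝ) ^ (-a)) ≤
      (randomPlanting G (⊤ : SimpleGraph (Fin k)) hk).toOuterMeasure
        {Ghat | ∃ S : Finset (Fin n), ReturnsVertexSet cliqueProgram Ghat S ∧
          Ghat.IsClique (S : Set (Fin n)) ∧ cliqueBound n c p ≤ (S.card : ℝ)} := by
  obtain ⟨τ, τ', hττ', hfew, hmany⟩ := exists_threshold h G hG
  obtain ⟨hn, hc, hc1, hp, hp1, -, -, -, -, hinv, hk2, hkn, hkp, hklog⟩ := h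
  have hn0 : 0 < n := by exact_mod_cast hn
  have hkn' : k ≤ n := by simpa using hk
  set D := denseVertices G τ' with hD
  set X := Fintype.card (Fin k ↪ Fin n) with hX
  -- the injections that hit one of the relevant sets less than half as often as expected
  let bad : Finset (Fin n) → Finset (Fin k ↪ Fin n) := fun A =>
    univ.filter fun φ => ((A ∩ univ.map φ).card : ℝ) ≤ (k : ℝ) * A.card / n / 2
  have hbad : ∀ A, ((bad A).card : ℝ) ≤ Real.exp (-(3 / 20) * (k * A.card / n)) * X := by
    intro A
    have := card_embedding_lowerTail_le (U := Fin k) hk (by simpa using hn0) A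
    simpa only [Fintype.card_fin] using this
  refine ofReal_le_randomPlanting G ⊤ hk (univ.biUnion (fun v => bad (nonNeighbors G v)) ∪ bad D)
    ?_ ?_
  · -- each of the two kinds of exceptional injections has probability at most `n ^ (-a) / 2`
    have hX0 : (0 : ℝ) ≤ X := Nat.cast_nonneg _
    have hhalf : Real.exp (-a * Real.log n - 1) ≤ (n : ℝ) ^ (-a) / 2 := by
      rw [Real.rpow_def_of_pos hn, Real.exp_sub, mul_comm (Real.log n)]
      have := Real.add_one_le_exp 1
      gcongr
      linarith
    have h1 : ∀ v, ((bad (nonNeighbors G v)).card : ℝ) ≤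
        Real.exp (-a * Real.log n - 1 - Real.log n) * X := by
      intro v
      refine (hbad _).trans (mul_le_mul_of_nonneg_right (Real.exp_le_exp.2 ?_) hX0)
      have h2 : (k : ℝ) * p ≤ k * (nonNeighbors G v).card / n := by
        rw [le_div_iff₀ hn, mul_assoc]
        exact mul_le_mul_of_nonneg_left (hG v) (Nat.cast_nonneg _)
      nlinarith
    have h2 : ((bad D).card : ℝ) ≤ Real.exp (-a * Real.log n - 1) * X := by
      refine (hbad _).trans (mul_le_mul_of_nonneg_right (Real.exp_le_exp.2 ?_) hX0)
      have h3 : c / 2 * D.card ≤ k * D.card / n := by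
        rw [mul_div_right_comm]
        gcongr
      have h4 : c ^ 2 / 45 * D.card ≤ c / 45 * D.card := by
        gcongr
        nlinarith
      nlinarith
    calc _ ≤ ((univ.biUnion (fun v => bad (nonNeighbors G v))).card : ℝ) + (bad D).card := by
          exact_mod_cast card_union_le _ _
      _ ≤ ∑ v : Fin n, ((bad (nonNeighbors G v)).card : ℝ) + (bad D).card := by
          gcongr
          exact_mod_cast card_biUnion_le
      _ ≤ ∑ v : Fin n, Real.exp (-a * Real.log n - 1 - Real.log n) * X +
          Real.exp (-a * Real.log n - 1) * X := by
          gcongr with v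
          exact h1 v
      _ = Real.exp (-a * Real.log n - 1) * X + Real.exp (-a * Real.log n - 1) * X := by
          rw [sum_const, card_univ, Fintype.card_fin, nsmul_eq_mul,
            Real.exp_sub _ (Real.log n), Real.exp_log hn]
          field_simp
      _ ≤ (n : ℝ) ^ (-a) / 2 * X + (n : ℝ) ^ (-a) / 2 * X := by gcongr
      _ = _ := by ring
  · intro φ hφ
    rw [mem_union, mem_biUnion, not_or] at hφ
    have hconc : ∀ v, (k : ℝ) * (nonNeighbors G v).card / n / 2 <
        ((nonNeighbors G v ∩ univ.map φ).card : ℝ) := by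
      intro v
      by_contra hlt
      exact hφ.1 ⟨v, mem_univ v, mem_filter.2 ⟨mem_univ _, not_lt.1 hlt⟩⟩
    have hconcD : (k : ℝ) * D.card / n / 2 < ((D ∩ univ.map φ).card : ℝ) := by
      by_contra hlt
      exact hφ.2 (mem_filter.2 ⟨mem_univ _, not_lt.1 hlt⟩)
    have hdense : n * n ≤ inputLog (plantClique G φ) * inputLog (plantClique G φ) *
        (1 + n + 2 * (plantClique G φ).edgeSet.ncard) := by
      have h1 : n ≤ k * inputLog (plantClique G φ) := by
        have := logb_le_inputLog (plantClique G φ) hn0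
        have h2 : (n : ℝ) ≤ k * inputLog (plantClique G φ) := hklog.trans (by gcongr)
        exact_mod_cast h2
      calc n * n ≤ (k * inputLog (plantClique G φ)) * (k * inputLog (plantClique G φ)) :=
            Nat.mul_le_mul h1 h1
        _ = inputLog (plantClique G φ) * inputLog (plantClique G φ) * (k * k) := by ring
        _ ≤ _ := Nat.mul_le_mul_left _ (sq_le_plantClique_edges G φ hkn')
    obtain ⟨S, hret, hclique, hS⟩ := cliqueProgram_returns (plantClique G φ) hn0 hdense
    refine ⟨S, hret, hclique, hmany.trans ?_⟩
    have h1 : ((D ∩ univ.map φ).card : ℝ) ≤ S.card + (denseVertices G τ).card := by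
      exact_mod_cast card_denseVertices_inter_le G φ hn0 hkn' hS hconc hττ'
    have h2 : (k : ℝ) * D.card / n / 2 = k / n / 2 * D.card := by ring
    have h3 : c ^ 2 / 45 ≤ k / n / 2 - c / 3 := by nlinarith
    have h4 := mul_le_mul_of_nonneg_right h3 (Nat.cast_nonneg (α := ℝ) D.card)
    linarith

end Guarantee

theorem mainTheorem1 :
    ∃ P : RAM.Program,
      (∀ (a : ℝ), 1 ≤ a →
        ∀ (c : ℕ → ℝ), (∀ n, 0 < c n ∧ c n ≤ 1) →
          (fun n : ℕ => 1 / Real.logb 2 (n : ℝ)) =o[atTop] c →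
          ∀ᶠ n : ℕ in atTop, ∀ (G : SimpleGraph (Fin n)) [DecidableRel G.Adj] (p : ℝ),
            p = 1 - (G.maxDegree : ℝ) / (n : ℝ) →
            1 + 2 * a * Real.log n ≤ cliqueBound n (c n) p →
            ∀ (k : ℕ) (hk : Fintype.card (Fin k) ≤ Fintype.card (Fin n)),
              |(k : ℝ) - c n * n| < 1 →
              ENNReal.ofReal (1 - (n : ℝ) ^ (-a)) ≤
                (randomPlanting G (⊤ : SimpleGraph (Fin k)) hk).toOuterMeasure
                  {Ghat | ∃ S : Finset (Fin n), ReturnsVertexSet P Ghat S ∧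
                    Ghat.IsClique (S : Set (Fin n)) ∧ cliqueBound n (c n) p ≤ (S.card : ℝ)}) ∧
      RunsInSoftLinearTime P := by
  refine ⟨cliqueProgram, ?_, cliqueProgram_runsInSoftLinearTime⟩
  intro a ha c hc hco
  filter_upwards [eventually_log_sq_le a, hco.def (show (0 : ℝ) < 1 / 4 by norm_num)] with
    n ⟨hlog, hlarge⟩ hclog G _ p hp hK k hk hkc
  have hn0 : 0 < n := by
    rcases Nat.eq_zero_or_pos n with h | h
    · rw [h] at hlog; norm_num at hlog
    · exact h
  have hn : (0 : ℝ) < n := by exact_mod_cast hn0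
  obtain ⟨hc0, hc1⟩ := hc n
  have : Nonempty (Fin n) := ⟨⟨0, hn0⟩⟩
  have hΔ : (G.maxDegree : ℝ) < n := by
    exact_mod_cast (G.maxDegree_lt_card_verts).trans_eq (Fintype.card_fin n)
  have hpn : p * n = n - G.maxDegree := by rw [hp]; field_simp
  have hp0 : 0 < p := by
    rw [hp, sub_pos, div_lt_one hn]; exact hΔ
  have hp1 : p ≤ 1 := by
    rw [hp]; linarith [show 0 ≤ (G.maxDegree : ℝ) / n by positivity]
  have hlogb : 0 ≤ Real.logb 2 n := Real.logb_nonneg (by norm_num) (by exact_mod_cast hn0)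
  rw [Real.norm_of_nonneg (by positivity), Real.norm_of_nonneg hc0.le] at hclog
  have hK1 : 1 ≤ cliqueBound n (c n) p := le_trans (by nlinarith) hK
  refine randomPlanting_ge (largeEnough ha hc0 hc1 hlog hlarge hclog hp0 hp1 hK1 hkc) ha hlog hK G
    (fun v => ?_) hk
  have h1 : (G.degree v : ℝ) + (nonNeighbors G v).card = n := by
    have h : G.degree v + (nonNeighbors G v).card = n := by
      convert degree_add_card_nonNeighbors G v
    exact_mod_cast h
  have h2 : (G.degree v : ℝ) ≤ G.maxDegree := by exact_mod_cast G.degree_le_maxDegree v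
  rw [hpn]
  linarith
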